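/- \textbf{Theorem (von Neumann's 1929 quantum ergodic theorem).} \emph{Setting.} Let $\mathscr H$ be a complex Hilbert space of finite dimension $D$, let $\hbar>0$, and let $H$ be a self-adjoint operator on $\mathscr H$ with an orthonormal eigenbasis $\phi_1,\dots,\phi_D$, $H\phi_\alpha=E_\alpha\phi_\alpha$. $H$ has \emph{no resonances} if $E_\alpha-E_\beta=E_{\alpha'}-E_{\beta'}$ holds only when $(\alpha,\beta)=(\alpha',\beta')$ or when $\alpha=\beta$ and $\alpha'=\beta'$. Let $\mathscr D=\{\mathscr H_1,\dots,\mathscr H_n\}$ be an orthogonal decomposition $\mathscr H=\bigoplus_\nu\mathscr H_\nu$, let $P_\nu$ be the orthogonal projection onto $\mathscr H_\nu$ and $d_\nu=\dim\mathscr H_\nu$. Put $\rho_{\mathrm{mc}}=D^{-1}I$ and $\psi_t=e^{-itH/\hbar}\psi_0$. A property holds for \emph{$(1-\delta')$-most} $t$ if, for the set $G$ of $t>0$ at which it holds, $\liminf_{T\to\infty}\frac1T\,|G\cap(0,T]|\ge 1-\delta'$. For a unit vector $\psi_0$, the system is \emph{$\varepsilon$-$\delta'$-normal} if for $(1-\delta')$-most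 $t$, $$\bigl|\langle\psi_t|A|\psi_t\rangle-\operatorname{tr}(\rho_{\mathrm{mc}}A)\bigr|<\varepsilon\sqrt{\operatorname{tr}(\rho_{\mathrm{mc}}A^2)}$$ for every nonzero real-linear combination $A=\sum_\nu a_\nu P_\nu$. The \emph{uniform distribution} over the orthogonal decompositions of $\mathscr H$ with given dimensions $d_1,\dots,d_n$, $\sum_\nu d_\nu=D$, is the law of $\{U\mathscr H^0_\nu\}_\nu$, where $\{\mathscr H^0_\nu\}_\nu$ is a fixed decomposition with these dimensions and $U$ is Haar distributed on the unitary group of $\mathscr H$. \emph{Statement.} (i) Let $\varepsilon,\delta'>0$, let $\mathscr D$ be an orthogonal decomposition of $\mathscr H$, let $H$ have no resonances, and suppose that, for all $\nu$, $$\max_{\alpha\ne\beta}\bigl|\langle\phi_\alpha|P_\nu|\phi_\beta\rangle\bigr|^2+\max_\alpha\Bigl(\langle\phi_\alpha|P_\nu|\phi_\alpha\rangle-\frac{d_\nu}{D}\Bigr)^2<\varepsilon^2\,\frac{d_\nu}{nD}\,\frac{\delta'}{n}\qquad(*)$$ (a maximum over the empty set is $0$). Then the system is $\varepsilon$-$\delta'$-normal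 for every unit vector $\psi_0\in\mathscr H$. (ii) There is a universal constant $C_1>0$ such that the following holds for all $\varepsilon,\delta,\delta'>0$, all $\mathscr H$ of finite dimension $D$, all $H$ without resonances, and all natural numbers $n$ and $d_1,\dots,d_n$ with $d_1+\dots+d_n=D$. If, for all $\nu$, $$\max\Bigl(C_1,\frac{10n^2}{\varepsilon^2\delta'\delta}\Bigr)\log D<d_\nu<\frac{D}{C_1},$$ then, with probability at least $1-\delta$, a uniformly distributed orthogonal decomposition of $\mathscr H$ with dimensions $d_1,\dots,d_n$ satisfies $(*)$ for all $\nu$, and the system is $\varepsilon$-$\delta'$-normal for every unit vector $\psi_0\in\mathscr H$. -/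

import Mathlib

open MeasureTheory Filter Topology

universe u

noncomputable section

namespace QuantumErgodic

section Algebra

variable {V : Type u} [NormedAddCommGroup V] [InnerProductSpace ℂ V]

/-- The numbers `E` have no resonances: `E α - E β = E α' - E β'` happens only in the trivial
cases `(α, β) = (α', β')` and `α = β, α' = β'`. -/
def NoResonances {D : ℕ} (E : Fin D → ℝ) : Prop :=
  ∀ α β α' β', E α - E β = E α' - E β' → (α = α' ∧ β = β') ∨ (α = β ∧ α' = β')

/-- `φ` is an orthonormal basis of eigenvectors of `H`, with eigenvalues `E`. -/
def IsEigenbasis {D : ℕ} (H : V →L[ℂ] V) (E : Fin D → ℝ) (φ : OrthonormalBasis (Fin D) ℂ V) :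
    Prop :=
  ∀ α, H (φ α) = (E α : ℂ) • φ α

/-- The state `ψ_t = exp(-i t H / ħ) ψ₀`, i.e. the solution of the Schrödinger equation
`i ħ ∂ψ/∂t = H ψ` with initial value `ψ₀`. -/
def evolve (ħ : ℝ) (H : V →L[ℂ] V) (ψ₀ : V) (t : ℝ) : V :=
  NormedSpace.exp ((-(Complex.I * t / ħ)) • H) ψ₀

/-- The micro-canonical density matrix: the identity divided by the dimension. -/
def rhoMC (V : Type u) [NormedAddCommGroup V] [InnerProductSpace ℂ V] : V →L[ℂ] V :=
  ((Module.finrank ℂ V : ℂ)⁻¹) • ContinuousLinearMap.id ℂ V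

/-- The trace of an operator. -/
def tr (A : V →L[ℂ] V) : ℂ := LinearMap.trace ℂ V (A : V →ₗ[ℂ] V)

/-- An orthogonal decomposition `V = ⨁ ν, space ν` into `n` mutually orthogonal subspaces with
prescribed dimensions `dim (space ν) = d ν`. -/
@[ext]
structure OrthDecomp (V : Type u) [NormedAddCommGroup V] [InnerProductSpace ℂ V]
    {n : ℕ} (d : Fin n → ℕ) where
  space : Fin n → Submodule ℂ V
  finrank_space : ∀ ν, Module.finrank ℂ (space ν) = d ν
  orthogonal : ∀ μ ν, μ ≠ ν → space μ ⟂ space ν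
  iSup_eq_top : ⨆ ν, space ν = ⊤

namespace OrthDecomp

variable {n : ℕ} {d : Fin n → ℕ}

/-- The orthogonal projection `P_ν` onto the `ν`-th subspace. -/
def proj [FiniteDimensional ℂ V] (𝒟 : OrthDecomp V d) (ν : Fin n) : V →L[ℂ] V :=
  (𝒟.space ν).starProjection

/-- The image of a decomposition under a unitary operator. -/
def rotate [CompleteSpace V] (U : unitary (V →L[ℂ] V)) (𝒟 : OrthDecomp V d) :
    OrthDecomp V d where
  space ν := (𝒟.space ν).map ((Unitary.linearIsometryEquiv U).toLinearEquiv : V →ₗ[ℂ] V)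
  finrank_space ν := by
    rw [← 𝒟.finrank_space ν]
    exact LinearEquiv.finrank_map_eq _ _
  orthogonal μ ν h := by
    have := 𝒟.orthogonal μ ν h
    rw [Submodule.isOrtho_iff_inner_eq] at this ⊢
    rintro _ ⟨x, hx, rfl⟩ _ ⟨y, hy, rfl⟩
    simpa using this x hx y hy
  iSup_eq_top := by
    rw [← Submodule.map_iSup, 𝒟.iSup_eq_top, Submodule.map_top]
    exact LinearEquiv.range _

/-- The decomposition that an orthonormal basis, grouped into blocks of sizes `d ν`, spans. -/
def ofBasis (b : OrthonormalBasis ((ν : Fin n) × Fin (d ν)) ℂ V) : OrthDecomp V d where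
  space ν := Submodule.span ℂ (Set.range fun i : Fin (d ν) => b ⟨ν, i⟩)
  finrank_space ν := by
    have h : LinearIndependent ℂ (fun i : Fin (d ν) => b ⟨ν, i⟩) :=
      b.orthonormal.linearIndependent.comp (fun i : Fin (d ν) => (⟨ν, i⟩ : (ν : Fin n) × Fin (d ν)))
        (fun i j h => by simpa using h)
    simpa using finrank_span_eq_card h
  orthogonal μ ν h := by
    rw [Submodule.isOrtho_span]
    rintro _ ⟨i, rfl⟩ _ ⟨j, rfl⟩
    exact b.orthonormal.2 (fun e => h (congrArg Sigma.fst e))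
  iSup_eq_top := by
    rw [← Submodule.span_iUnion, ← b.toBasis.span_eq]
    congr 1
    ext x
    simp

/-- Some fixed decomposition with prescribed dimensions `d ν`. -/
def standard [FiniteDimensional ℂ V] (hd : ∑ ν, d ν = Module.finrank ℂ V) : OrthDecomp V d :=
  ofBasis ((stdOrthonormalBasis ℂ V).reindex
    ((finCongr hd.symm).trans finSigmaFinEquiv.symm))

/-- Decompositions carry the σ-algebra generated by the tuple of their projections. -/
instance [FiniteDimensional ℂ V] : MeasurableSpace (OrthDecomp V d) :=
  MeasurableSpace.comap (fun 𝒟 : OrthDecomp V d => fun ν => 𝒟.proj ν) inferInstance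

end OrthDecomp

end Algebra

section Uniform

variable {V : Type u} [NormedAddCommGroup V] [InnerProductSpace ℂ V] [CompleteSpace V]
  [FiniteDimensional ℂ V]

instance : CompactSpace (unitary (V →L[ℂ] V)) := by
  have : ProperSpace (V →L[ℂ] V) := FiniteDimensional.proper ℂ _
  refine isCompact_iff_compactSpace.mp (Metric.isCompact_of_isClosed_isBounded
    (isClosed_unitary (R := V →L[ℂ] V)) ?_)
  refine (Metric.isBounded_closedBall (x := (0 : V →L[ℂ] V)) (r := 1)).subset ?_
  intro U hU
  rw [mem_closedBall_zero_iff]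
  refine ContinuousLinearMap.opNorm_le_bound _ zero_le_one fun x => ?_
  rw [one_mul]
  exact ((Unitary.linearIsometryEquiv ⟨U, hU⟩).norm_map x).le

variable (V) in
/-- The Haar probability measure on the unitary group of `V`. -/
def haarUnitary : Measure (unitary (V →L[ℂ] V)) := Measure.haarMeasure ⊤

/-- The uniform distribution over all orthogonal decompositions with prescribed dimensions: the
law of a fixed decomposition rotated by a Haar distributed unitary operator. -/
def uniformDecomp {n : ℕ} {d : Fin n → ℕ} (hd : ∑ ν, d ν = Module.finrank ℂ V) :
    Measure (OrthDecomp V d) :=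
  (haarUnitary V).map fun U => (OrthDecomp.standard hd).rotate U

/-- The rotated decomposition depends measurably on the unitary operator. -/
lemma measurable_rotate {n : ℕ} {d : Fin n → ℕ} (𝒟 : OrthDecomp V d) :
    Measurable fun U : unitary (V →L[ℂ] V) => 𝒟.rotate U := by
  rw [measurable_comap_iff]
  refine measurable_pi_lambda _ fun ν => ?_
  have h : (fun U : unitary (V →L[ℂ] V) => (𝒟.rotate U).proj ν) =
      fun U : unitary (V →L[ℂ] V) => (U : V →L[ℂ] V) * 𝒟.proj ν * star (U : V →L[ℂ] V) := by
    funext U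
    ext x
    have := Submodule.starProjection_map_apply (Unitary.linearIsometryEquiv U) (𝒟.space ν) x
    exact this
  have hc : Continuous fun U : unitary (V →L[ℂ] V) =>
      (U : V →L[ℂ] V) * 𝒟.proj ν * star (U : V →L[ℂ] V) :=
    (continuous_subtype_val.mul continuous_const).mul continuous_subtype_val.star
  show Measurable (fun U : unitary (V →L[ℂ] V) => (𝒟.rotate U).proj ν)
  rw [h]
  exact hc.measurable

instance {n : ℕ} {d : Fin n → ℕ} (hd : ∑ ν, d ν = Module.finrank ℂ V) :
    IsProbabilityMeasure (uniformDecomp (V := V) hd) := by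
  have : IsProbabilityMeasure (haarUnitary V) := ⟨Measure.haarMeasure_self (K₀ := ⊤)⟩
  exact Measure.isProbabilityMeasure_map (measurable_rotate _).aemeasurable

end Uniform

section Normality

variable {V : Type u} [NormedAddCommGroup V] [InnerProductSpace ℂ V] [FiniteDimensional ℂ V]
  {n : ℕ} {d : Fin n → ℕ}

/-- `p t` holds for `(1 - δ)`-most times `t > 0`: in the long run, the fraction of times in
`(0, T]` at which `p` holds is at least `1 - δ`. -/
def MostTimes (δ : ℝ) (p : ℝ → Prop) : Prop :=
  1 - δ ≤ liminf (fun T : ℝ => volume.real {t | t ∈ Set.Ioc 0 T ∧ p t} / T) atTop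

/-- `ε`-`δ'`-normality of the system given by `H`, the decomposition `𝒟` and the initial
state `ψ₀`: for `(1 - δ')`-most `t`, all nonzero real-linear combinations `A` of the projections
satisfy `|⟨ψ_t|A|ψ_t⟩ - tr(ρ_mc A)| < ε √tr(ρ_mc A²)`. (For `A = 0` both sides vanish.) -/
def IsNormal (ħ : ℝ) (H : V →L[ℂ] V) (𝒟 : OrthDecomp V d) (ε δ' : ℝ) (ψ₀ : V) : Prop :=
  MostTimes δ' fun t =>
    ∀ (a : Fin n → ℝ) (A : V →L[ℂ] V), A = ∑ ν, (a ν : ℂ) • 𝒟.proj ν → A ≠ 0 →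
      ‖inner ℂ (evolve ħ H ψ₀ t) (A (evolve ħ H ψ₀ t)) - tr (rhoMC V * A)‖
        < ε * √(tr (rhoMC V * A ^ 2)).re

/-- The largest squared off-diagonal matrix element of `P_ν` in the basis `φ`, plus the largest
squared deviation of a diagonal one from `d_ν / D`. The maximum over an empty index set is `0`. -/
def maxDeviation {D : ℕ} (φ : OrthonormalBasis (Fin D) ℂ V) (𝒟 : OrthDecomp V d) (ν : Fin n) :
    ℝ :=
  (⨆ p : {p : Fin D × Fin D // p.1 ≠ p.2}, ‖inner ℂ (φ p.1.1) (𝒟.proj ν (φ p.1.2))‖ ^ 2) +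
    ⨆ α : Fin D, ‖inner ℂ (φ α) (𝒟.proj ν (φ α)) - (d ν / D : ℂ)‖ ^ 2

/-- The smallness condition on the macro-spaces relative to the energy eigenbasis `φ`. -/
def SmallDeviation {D : ℕ} (φ : OrthonormalBasis (Fin D) ℂ V) (𝒟 : OrthDecomp V d) (ε δ' : ℝ) :
    Prop :=
  ∀ ν, maxDeviation φ 𝒟 ν < ε ^ 2 * (d ν / (n * D)) * (δ' / n)

end Normality

end QuantumErgodic

end

/-! Deterministic half. In the eigenbasis, `⟨ψ_t|P_ν|ψ_t⟩ - d_ν/D` is a trigonometric polynomial in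
`t`. Without resonances its frequencies are distinct, so by Parseval (`tendsto_average_norm_sq`) its
long-time mean square is the sum of the squared coefficients. This sum is at most `maxDeviation`,
whatever the state, because the weights `|⟨φ_α|ψ₀⟩|²` sum to one. Markov's inequality for a
normalised sum over `ν` yields times that are good for all `ν` at once, and Cauchy–Schwarz passes to
all linear combinations.

Probabilistic half. For a unit vector `χ`, the vector `U* χ` is uniform on the sphere, so `⟨χ|U P_ν
U*|χ⟩` is the weight of a random unit vector on `d_ν` coordinates. The sign of a quadratic form
depends only on direction, so the sphere may be replaced by a Gaussian vector, whose coordinates are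
independent; this gives the Chernoff bound `haarUnitary_quadratic_nonneg_le`. By polarization, `3
D²` test vectors control every matrix element, off-diagonal ones included. A union bound over test
vectors and over the `n ≤ D` subspaces finishes the proof. -/

namespace QuantumErgodic

/-! ### Chernoff bound on the sphere by comparison with a Gaussian vector. -/

section HaarTail

variable {V : Type u} [NormedAddCommGroup V] [InnerProductSpace ℂ V] [FiniteDimensional ℂ V]

/-- The unitary group acts transitively on the unit sphere. -/
lemma exists_unitary_map_eq [CompleteSpace V] {x y : V} (hx : ‖x‖ = 1) (hy : ‖y‖ = 1) :
    ∃ W : unitary (V →L[ℂ] V), (W : V →L[ℂ] V) x = y := by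
  have hpos : 0 < Module.finrank ℂ V := by
    refine Module.finrank_pos_iff_exists_ne_zero.mpr ⟨x, ?_⟩
    rintro rfl
    simp at hx
  let i₀ : Fin (Module.finrank ℂ V) := ⟨0, hpos⟩
  have key : ∀ z : V, ‖z‖ = 1 →
      ∃ b : OrthonormalBasis (Fin (Module.finrank ℂ V)) ℂ V, b i₀ = z := by
    intro z hz
    have ho : Orthonormal ℂ (({i₀} : Set (Fin (Module.finrank ℂ V))).domRestrict fun _ => z) := by
      refine ⟨fun _ => hz, fun i j hij => ?_⟩
      exact absurd (Subsingleton.elim i j) hij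
    obtain ⟨b, hb⟩ := ho.exists_orthonormalBasis_extension_of_card_eq (by simp)
    exact ⟨b, hb i₀ rfl⟩
  obtain ⟨b, hb⟩ := key x hx
  obtain ⟨c, hc⟩ := key y hy
  refine ⟨Unitary.linearIsometryEquiv.symm (b.equiv c (Equiv.refl _)), ?_⟩
  rw [Unitary.coe_symm_linearIsometryEquiv_apply, ← hb, ← hc]
  simp

/-- The real determinant of a complex operator that is diagonal with real entries `s i`. -/
lemma det_restrictScalars_diagonal {ι : Type*} [Fintype ι] [DecidableEq ι]
    (b : Module.Basis ι ℂ V) (s : ι → ℝ) :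
    LinearMap.det ((Matrix.toLin b b (Matrix.diagonal fun i => (s i : ℂ))).restrictScalars ℝ) =
      ∏ i, s i ^ 2 := by
  rw [LinearMap.det_restrictScalars, LinearMap.det_toLin, Matrix.det_diagonal,
    ← Complex.ofReal_prod, Algebra.norm_complex_apply, Complex.normSq_ofReal, Finset.prod_pow, sq]

section Gaussian

variable [MeasurableSpace V] [BorelSpace V] (μ : Measure V) [μ.IsAddHaarMeasure]

/-- Needed to cancel this integral as a normalising constant. -/
lemma lintegral_gaussian_pos_finite :
    (∫⁻ z, ENNReal.ofReal (Real.exp (-‖z‖ ^ 2)) ∂μ) ≠ 0 ∧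
      (∫⁻ z, ENNReal.ofReal (Real.exp (-‖z‖ ^ 2)) ∂μ) ≠ ⊤ := by
  let _ : InnerProductSpace ℝ V := InnerProductSpace.rclikeToReal ℂ V
  have h := GaussianFourier.integral_rexp_neg_mul_sq_norm (V := V) (b := 1) one_pos
  simp only [neg_mul, one_mul, div_one] at h
  have hpos : (0 : ℝ) < Real.pi ^ (Module.finrank ℝ V / 2 : ℝ) := by positivity
  have hint : Integrable fun z : V => Real.exp (-‖z‖ ^ 2) := by
    by_contra hcon
    rw [integral_undef hcon] at h
    exact hpos.ne h
  have hμ := Measure.isAddLeftInvariant_eq_smul μ volume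
  rw [hμ, lintegral_smul_measure,
    ← ofReal_integral_eq_lintegral_ofReal hint (ae_of_all _ fun _ => (Real.exp_pos _).le), h]
  refine ⟨?_, ENNReal.mul_ne_top ENNReal.coe_ne_top ENNReal.ofReal_ne_top⟩
  refine mul_ne_zero ?_ (by simpa using hpos)
  exact_mod_cast (Measure.addHaarScalarFactor_pos_of_isAddHaarMeasure μ volume).ne'

/-- Substitute `z ↦ T z`, where `T` scales the `i`-th coordinate by `√(c i)`. A complex coordinate
is two real dimensions, so the Jacobian is `∏ c i` and not its square root. -/
lemma lintegral_exp_neg_sum {ι : Type*} [Fintype ι] (b : OrthonormalBasis ι ℂ V)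
    {c : ι → ℝ} (hc : ∀ i, 0 < c i) :
    ∫⁻ z, ENNReal.ofReal (Real.exp (-∑ i, c i * ‖inner ℂ (b i) z‖ ^ 2)) ∂μ =
      ENNReal.ofReal (∏ i, (c i)⁻¹) * ∫⁻ z, ENNReal.ofReal (Real.exp (-‖z‖ ^ 2)) ∂μ := by
  classical
  set T : V →ₗ[ℂ] V := Matrix.toLin b.toBasis b.toBasis
    (Matrix.diagonal fun i => ((√(c i) : ℝ) : ℂ)) with hT
  have hTz : ∀ z i, inner ℂ (b i) (T z) = √(c i) * inner ℂ (b i) z := by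
    intro z i
    have := congrFun (Matrix.repr_toLin b.toBasis b.toBasis
      (Matrix.diagonal fun i => ((√(c i) : ℝ) : ℂ)) z) i
    simpa [Matrix.mulVec_diagonal, b.repr_apply_apply] using this
  have hnorm : ∀ z, ‖T z‖ ^ 2 = ∑ i, c i * ‖inner ℂ (b i) z‖ ^ 2 := by
    intro z
    rw [← b.sum_sq_norm_inner_right]
    refine Finset.sum_congr rfl fun i _ => ?_
    rw [hTz, norm_mul, mul_pow, Complex.norm_real, Real.norm_eq_abs, sq_abs,
      Real.sq_sqrt (hc i).le]
  have hdet : LinearMap.det (T.restrictScalars ℝ) = ∏ i, c i := by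
    rw [hT, det_restrictScalars_diagonal]
    exact Finset.prod_congr rfl fun i _ => Real.sq_sqrt (hc i).le
  have hdet0 : 0 < ∏ i, c i := Finset.prod_pos fun i _ => hc i
  have hmap := Measure.map_linearMap_addHaar_eq_smul_addHaar μ
    (f := T.restrictScalars ℝ) (by rw [hdet]; exact hdet0.ne')
  have hTm : Measurable (T.restrictScalars ℝ) :=
    (LinearMap.continuous_of_finiteDimensional T).measurable
  have hm : Measurable fun z : V => ENNReal.ofReal (Real.exp (-‖z‖ ^ 2)) := by fun_prop
  have := lintegral_map (μ := μ) hm hTm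
  rw [hmap, lintegral_smul_measure, hdet, abs_of_pos (inv_pos.mpr hdet0),
    ← Finset.prod_inv_distrib] at this
  simp only [LinearMap.coe_restrictScalars, hnorm] at this
  rw [← this, smul_eq_mul]

/-- Unitary operators preserve the Lebesgue measure. -/
lemma map_linearIsometryEquiv_addHaar (f : V ≃ₗᵢ[ℂ] V) : μ.map f = μ := by
  let _ : InnerProductSpace ℝ V := InnerProductSpace.rclikeToReal ℂ V
  have h : (volume : Measure V).map f = volume :=
    (LinearIsometryEquiv.measurePreserving
      ((f.toLinearEquiv.restrictScalars ℝ).isometryOfInner (by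
        intro x y
        simp [real_inner_eq_re_inner]))).map_eq
  rw [Measure.isAddLeftInvariant_eq_smul μ volume, Measure.map_smul, h]

end Gaussian

/-- Chernoff bound for a quadratic form, diagonal in some orthonormal basis, at a uniformly
distributed point of the unit sphere. -/
lemma haarUnitary_quadratic_nonneg_le [CompleteSpace V] {ι : Type*} [Fintype ι]
    (b : OrthonormalBasis ι ℂ V) {w : ι → ℝ} (hw : ∀ i, w i < 1) {χ : V} (hχ : ‖χ‖ = 1) :
    haarUnitary V {U | 0 ≤ ∑ i, w i * ‖inner ℂ (b i) (star (U : V →L[ℂ] V) χ)‖ ^ 2} ≤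
      ENNReal.ofReal (∏ i, (1 - w i)⁻¹) := by
  borelize V
  have : SecondCountableTopology (V →L[ℂ] V) := by
    have : ProperSpace (V →L[ℂ] V) := FiniteDimensional.proper ℂ _
    infer_instance
  have : IsProbabilityMeasure (haarUnitary V) := ⟨Measure.haarMeasure_self (K₀ := ⊤)⟩
  have hinv : (haarUnitary V).IsMulLeftInvariant := by unfold haarUnitary; infer_instance
  have hnt : Nontrivial V := ⟨χ, 0, by rintro rfl; simp at hχ⟩
  let μ : Measure V := Measure.addHaar
  set q : V → ℝ := fun z => ∑ i, w i * ‖inner ℂ (b i) z‖ ^ 2 with hq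
  have hqc : Continuous q := by fun_prop
  set g : V → ENNReal := fun z => ENNReal.ofReal (Real.exp (-‖z‖ ^ 2)) with hg
  have hgm : Measurable g := by fun_prop
  set p := haarUnitary V {U | 0 ≤ q (star (U : V →L[ℂ] V) χ)} with hp
  have hstar : ∀ (U : unitary (V →L[ℂ] V)) (z : V), ‖star (U : V →L[ℂ] V) z‖ = ‖z‖ := fun U z =>
    (Unitary.linearIsometryEquiv (star U)).norm_map z
  have hscale : ∀ (r : ℝ) (z : V), q ((r : ℂ) • z) = r ^ 2 * q z := by
    intro r z
    simp only [hq, inner_smul_right, norm_mul, Complex.norm_real, mul_pow, Real.norm_eq_abs,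
      sq_abs, Finset.mul_sum]
    exact Finset.sum_congr rfl fun i _ => by ring
  -- the Haar probability does not depend on the direction
  have hdir : ∀ z : V, z ≠ 0 → haarUnitary V {U | 0 ≤ q (star (U : V →L[ℂ] V) z)} = p := by
    intro z hz
    have hz' : ‖z‖ ≠ 0 := norm_ne_zero_iff.mpr hz
    obtain ⟨W, hW⟩ := exists_unitary_map_eq (x := ((‖z‖⁻¹ : ℝ) : ℂ) • z) (y := χ)
      (by rw [norm_smul, Complex.norm_real, norm_inv, norm_norm, inv_mul_cancel₀ hz']) hχ
    rw [hp, ← measure_preimage_mul (haarUnitary V) W {U | 0 ≤ q (star (U : V →L[ℂ] V) χ)}]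
    congr 1
    ext U
    have hWs : star (W : V →L[ℂ] V) χ = ((‖z‖⁻¹ : ℝ) : ℂ) • z := by
      rw [← hW, ← mul_apply_eq_comp, Unitary.coe_star_mul_self,
        one_apply_eq_self]
    have : star ((W * U : unitary (V →L[ℂ] V)) : V →L[ℂ] V) χ =
        ((‖z‖⁻¹ : ℝ) : ℂ) • star (U : V →L[ℂ] V) z := by
      rw [Submonoid.coe_mul, star_mul, mul_apply_eq_comp, hWs, map_smul]
    rw [Set.mem_preimage, Set.mem_ofPred_eq, Set.mem_ofPred_eq, this, hscale]
    have : 0 < ‖z‖⁻¹ ^ 2 := by positivity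
    exact (mul_nonneg_iff_of_pos_left this).symm
  obtain ⟨hI0, hItop⟩ := lintegral_gaussian_pos_finite μ
  have hB : MeasurableSet {z | 0 ≤ q z} := (isClosed_Ici.preimage hqc).measurableSet
  have hjoint : Measurable fun x : unitary (V →L[ℂ] V) × V =>
      {z | 0 ≤ q z}.indicator g (star (x.1 : V →L[ℂ] V) x.2) := by
    refine (hgm.indicator hB).comp (Continuous.measurable ?_)
    exact (continuous_subtype_val.comp continuous_fst).star.clm_apply continuous_snd
  -- Fubini on pairs `(U, z)`: for fixed `z ≠ 0` the Haar average is `p * g z`, as `g` depends only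
  -- on the norm; for fixed `U` the Lebesgue integral does not see the rotation.
  have key : p * ∫⁻ z, g z ∂μ = ∫⁻ z, {z | 0 ≤ q z}.indicator g z ∂μ := by
    calc p * ∫⁻ z, g z ∂μ = ∫⁻ z, p * g z ∂μ := (lintegral_const_mul _ hgm).symm
      _ = ∫⁻ z, ∫⁻ U, {z | 0 ≤ q z}.indicator g (star (U : V →L[ℂ] V) z) ∂haarUnitary V ∂μ := by
        refine lintegral_congr_ae ?_
        filter_upwards [Measure.ae_ne μ 0] with z hz
        rw [← hdir z hz, mul_comm, ← lintegral_indicator_const]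
        · refine lintegral_congr fun U => ?_
          simp only [Set.indicator, Set.mem_ofPred_eq, hg, hstar]
        · refine measurableSet_le measurable_const (hqc.comp ?_).measurable
          exact continuous_subtype_val.star.clm_apply continuous_const
      _ = ∫⁻ U, ∫⁻ z, {z | 0 ≤ q z}.indicator g (star (U : V →L[ℂ] V) z) ∂μ ∂haarUnitary V := by
        refine lintegral_lintegral_swap ?_
        exact (hjoint.comp measurable_swap).aemeasurable
      _ = ∫⁻ _U : unitary (V →L[ℂ] V), ∫⁻ z, {z | 0 ≤ q z}.indicator g z ∂μ ∂haarUnitary V := by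
        refine lintegral_congr fun U => ?_
        have h := map_linearIsometryEquiv_addHaar μ (Unitary.linearIsometryEquiv (star U))
        conv_rhs => rw [← h]
        rw [lintegral_map (hgm.indicator hB) (LinearIsometryEquiv.continuous _).measurable]
        rfl
      _ = _ := by simp
  -- The indicator of `0 ≤ q` is at most `exp q`, and `exp (q z - ‖z‖ ^ 2)` is a Gaussian with
  -- coefficients `1 - w i > 0`.
  have hexp : ∫⁻ z, {z | 0 ≤ q z}.indicator g z ∂μ ≤
      ENNReal.ofReal (∏ i, (1 - w i)⁻¹) * ∫⁻ z, g z ∂μ := by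
    rw [← lintegral_exp_neg_sum μ b (fun i => sub_pos.mpr (hw i))]
    refine lintegral_mono fun z => ?_
    by_cases hz : z ∈ {z | 0 ≤ q z}
    swap
    · rw [Set.indicator_of_notMem hz]
      exact zero_le
    rw [Set.indicator_of_mem hz]
    refine ENNReal.ofReal_le_ofReal (Real.exp_le_exp.mpr ?_)
    have hz' : 0 ≤ q z := hz
    simp only [sub_mul, one_mul, Finset.sum_sub_distrib, b.sum_sq_norm_inner_right]
    simp only [hq] at hz'
    linarith
  exact (ENNReal.mul_le_mul_iff_left hI0 hItop).mp (key.trans_le hexp)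

end HaarTail
-- Concentration of the weight on a set of coordinates.
section Deviation

variable {V : Type u} [NormedAddCommGroup V] [InnerProductSpace ℂ V] [FiniteDimensional ℂ V]

lemma inv_one_sub_le_exp {u : ℝ} (hu : |u| ≤ 1 / 2) : (1 - u)⁻¹ ≤ Real.exp (u + 2 * u ^ 2) := by
  obtain ⟨h₁, h₂⟩ := abs_le.mp hu
  rw [inv_le_iff_one_le_mul₀ (by linarith)]
  have h := Real.add_one_le_exp (u + 2 * u ^ 2)
  have h' : 1 ≤ (u + 2 * u ^ 2 + 1) * (1 - u) := by nlinarith [sq_nonneg u]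
  exact h'.trans (mul_le_mul_of_nonneg_right h (by linarith))

/-- One-sided deviation (`σ = 1` or `σ = -1`) of the weight of a uniformly distributed unit
vector on a set `S` of basis vectors from its mean. -/
lemma haarUnitary_weight_deviation_le [CompleteSpace V] {ι : Type*} [Fintype ι] [DecidableEq ι]
    (b : OrthonormalBasis ι ℂ V) (S : Finset ι) {p r m σ : ℝ}
    (hp : (S.card : ℝ) = p * Fintype.card ι) (hσ : σ ^ 2 = 1)
    (hr : 0 < r) (hr1 : r ≤ 1) (hm : 0 ≤ m) (hmr : m ≤ r) (hmp : m * p ≤ r ^ 2)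
    {χ : V} (hχ : ‖χ‖ = 1) :
    haarUnitary V
        {U | r ≤ σ * (∑ i ∈ S, ‖inner ℂ (b i) (star (U : V →L[ℂ] V) χ)‖ ^ 2 - p)} ≤
      ENNReal.ofReal (Real.exp (-(Fintype.card ι * m / 16))) := by
  set N : ℝ := (Fintype.card ι : ℝ) with hN
  have hσ' : σ = 1 ∨ σ = -1 := by simpa using hσ
  have hN0 : 0 < N := by
    have : Nonempty ι := by
      by_contra hcon
      rw [not_nonempty_iff] at hcon
      have := b.sum_sq_norm_inner_right χ
      simp [hχ] at this
    rw [hN]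
    exact_mod_cast Fintype.card_pos
  have hSN : (S.card : ℝ) ≤ N := by rw [hN]; exact_mod_cast S.card_le_univ
  have hp0 : 0 ≤ p := by
    by_contra hcon
    have : (0 : ℝ) ≤ S.card := by positivity
    nlinarith
  have hp1 : p ≤ 1 := by
    by_contra hcon
    nlinarith
  -- Chernoff parameter. It makes the second-order term at most half of the linear gain `l * r * N`,
  -- leaving `l * r * N / 2 = N * m / 16` in the exponent.
  set l : ℝ := m / (8 * r) with hl
  have hl0 : 0 ≤ l := by positivity
  have hlr : l * (8 * r) = m := by rw [hl]; field_simp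
  have hl8 : l ≤ 1 / 8 := by
    rw [hl, div_le_iff₀ (by positivity)]; linarith
  have hlp : l * p ≤ r / 8 := by
    rw [hl, div_mul_eq_mul_div, div_le_iff₀ (by positivity)]; nlinarith
  -- On the unit sphere the constants `p` and `r` may be multiplied by the total weight `1`; this
  -- turns the deviation event into nonnegativity of a homogeneous quadratic form.
  set w : ι → ℝ := fun i => l * (σ * ((if i ∈ S then 1 else 0) - p) - r) with hw
  have hwabs : ∀ i, |w i| ≤ 1 / 2 := by
    intro i
    have h2 : |σ * ((if i ∈ S then 1 else 0) - p) - r| ≤ 2 := by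
      rw [abs_le]
      rcases hσ' with rfl | rfl <;> split_ifs <;> constructor <;> linarith
    rw [hw, abs_mul, abs_of_nonneg hl0]
    nlinarith [abs_nonneg (σ * ((if i ∈ S then 1 else 0) - p) - r)]
  have hind : ∑ i, (if i ∈ S then (1 : ℝ) else 0) = p * N := by
    rw [← hp]; simp
  have hsum : ∑ i, w i = -(l * r * N) := by
    simp only [hw, ← Finset.mul_sum, Finset.sum_sub_distrib, hind]
    simp [← hN]
    ring
  have hsq : ∑ i, w i ^ 2 = l ^ 2 * N * (p + r ^ 2 - p ^ 2) := by
    have : ∀ i, w i ^ 2 = l ^ 2 * ((1 - 2 * p - 2 * σ * r) * (if i ∈ S then 1 else 0) +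
        (p ^ 2 + r ^ 2 + 2 * σ * p * r)) := by
      intro i
      simp only [hw]
      split_ifs
      · linear_combination l ^ 2 * (1 - p) ^ 2 * hσ
      · linear_combination l ^ 2 * p ^ 2 * hσ
    simp only [this, ← Finset.mul_sum, Finset.sum_add_distrib, hind]
    simp [← hN]
    ring
  refine (measure_mono ?_).trans ((haarUnitary_quadratic_nonneg_le b (w := w)
    (fun i => by linarith [(abs_le.mp (hwabs i)).2]) hχ).trans ?_)
  · intro U hU
    have hU' : r ≤ σ * (∑ i ∈ S, ‖inner ℂ (b i) (star (U : V →L[ℂ] V) χ)‖ ^ 2 - p) := hU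
    have h1 : ∑ i, ‖inner ℂ (b i) (star (U : V →L[ℂ] V) χ)‖ ^ 2 = 1 := by
      rw [b.sum_sq_norm_inner_right]
      have : ‖star (U : V →L[ℂ] V) χ‖ = ‖χ‖ := (Unitary.linearIsometryEquiv (star U)).norm_map χ
      rw [this, hχ, one_pow]
    have h2 : ∑ i, w i * ‖inner ℂ (b i) (star (U : V →L[ℂ] V) χ)‖ ^ 2 =
        l * (σ * (∑ i ∈ S, ‖inner ℂ (b i) (star (U : V →L[ℂ] V) χ)‖ ^ 2 - p) - r) := by
      have : ∀ i, w i * ‖inner ℂ (b i) (star (U : V →L[ℂ] V) χ)‖ ^ 2 =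
          l * σ * (if i ∈ S then ‖inner ℂ (b i) (star (U : V →L[ℂ] V) χ)‖ ^ 2 else 0) -
          l * (σ * p + r) * ‖inner ℂ (b i) (star (U : V →L[ℂ] V) χ)‖ ^ 2 := by
        intro i
        simp only [hw]
        split_ifs <;> ring
      simp only [this, Finset.sum_sub_distrib, ← Finset.mul_sum, h1, Finset.sum_ite_mem,
        Finset.univ_inter]
      ring
    show (0 : ℝ) ≤ _
    rw [h2]
    exact mul_nonneg hl0 (by linarith)
  · refine ENNReal.ofReal_le_ofReal ?_
    calc ∏ i, (1 - w i)⁻¹ ≤ ∏ i, Real.exp (w i + 2 * w i ^ 2) := by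
          refine Finset.prod_le_prod (fun i _ => ?_) fun i _ => inv_one_sub_le_exp (hwabs i)
          exact inv_nonneg.mpr (by linarith [(abs_le.mp (hwabs i)).2])
      _ = Real.exp (-(l * r * N) + 2 * (l ^ 2 * N * (p + r ^ 2 - p ^ 2))) := by
          rw [← Real.exp_sum, Finset.sum_add_distrib, hsum, ← Finset.mul_sum, hsq]
      _ ≤ _ := by
          refine Real.exp_le_exp.mpr ?_
          have h1 : l * (p + r ^ 2 - p ^ 2) ≤ r / 4 := by nlinarith [mul_nonneg hl0 (sq_nonneg p)]
          have h2 : l * N * (l * (p + r ^ 2 - p ^ 2)) ≤ l * N * (r / 4) :=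
            mul_le_mul_of_nonneg_left h1 (by positivity)
          have h3 : N * m = 8 * (l * N * r) := by rw [← hlr]; ring
          nlinarith

/-- Union of the two signs. For `r > 1` the event is empty, as the weight and `p` both lie in `[0,
1]`. -/
lemma haarUnitary_abs_weight_deviation_le [CompleteSpace V] {ι : Type*} [Fintype ι] [DecidableEq ι]
    (b : OrthonormalBasis ι ℂ V) (S : Finset ι) {p r m : ℝ}
    (hp : (S.card : ℝ) = p * Fintype.card ι) (hp0 : 0 ≤ p) (hp1 : p ≤ 1)
    (hr : 0 < r) (hm : 0 ≤ m) (hmr : m ≤ r) (hmp : m * p ≤ r ^ 2) {χ : V} (hχ : ‖χ‖ = 1) :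
    haarUnitary V
        {U | r ≤ |∑ i ∈ S, ‖inner ℂ (b i) (star (U : V →L[ℂ] V) χ)‖ ^ 2 - p|} ≤
      ENNReal.ofReal (2 * Real.exp (-(Fintype.card ι * m / 16))) := by
  rcases le_or_gt r 1 with hr1 | hr1
  · have h₁ := haarUnitary_weight_deviation_le b S hp (σ := 1) (by norm_num) hr hr1 hm hmr hmp hχ
    have h₂ := haarUnitary_weight_deviation_le b S hp (σ := -1) (by norm_num) hr hr1 hm hmr hmp hχ
    rw [two_mul, ENNReal.ofReal_add (Real.exp_pos _).le (Real.exp_pos _).le]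
    refine (measure_mono ?_).trans ((measure_union_le _ _).trans (add_le_add h₁ h₂))
    intro U hU
    rcases le_abs.mp (show r ≤ _ from hU) with h | h
    · left
      show r ≤ _
      linarith
    · right
      show r ≤ _
      linarith
  · have hempty : {U : unitary (V →L[ℂ] V) |
        r ≤ |∑ i ∈ S, ‖inner ℂ (b i) (star (U : V →L[ℂ] V) χ)‖ ^ 2 - p|} = ∅ := by
      refine Set.eq_empty_of_forall_notMem fun U hU => ?_
      have hU' : r ≤ |∑ i ∈ S, ‖inner ℂ (b i) (star (U : V →L[ℂ] V) χ)‖ ^ 2 - p| := hU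
      have h1 : ∑ i ∈ S, ‖inner ℂ (b i) (star (U : V →L[ℂ] V) χ)‖ ^ 2 ≤ 1 := by
        refine (Finset.sum_le_univ_sum_of_nonneg fun i => by positivity).trans ?_
        rw [b.sum_sq_norm_inner_right]
        have : ‖star (U : V →L[ℂ] V) χ‖ = ‖χ‖ := (Unitary.linearIsometryEquiv (star U)).norm_map χ
        rw [this, hχ, one_pow]
      have h0 : 0 ≤ ∑ i ∈ S, ‖inner ℂ (b i) (star (U : V →L[ℂ] V) χ)‖ ^ 2 :=
        Finset.sum_nonneg fun i _ => by positivity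
      have : |∑ i ∈ S, ‖inner ℂ (b i) (star (U : V →L[ℂ] V) χ)‖ ^ 2 - p| ≤ 1 := by
        rw [abs_le]; constructor <;> linarith
      linarith
    rw [hempty, measure_empty]
    exact zero_le

end Deviation

/-! ### The numerical budget of the union bound. -/

section Numerics

/-- The prefactor dominates `n ≤ D` subspaces times `3 D²` test vectors times two signs. With `y =
δ^(-1/2)` and `L = log D`, the exponent is at least `4 * L + 2 * y`: the first term beats `D ^ 3`,
and the second yields `δ` since `exp (2 * y) ≥ y ^ 2`. -/
lemma six_mul_cube_mul_exp_le {D p r δ : ℝ} (hD : 10 ^ 10 ≤ D) (hδ : 0 < δ) (hδ1 : δ ≤ 1)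
    (hp : 0 < p) (hpD : p ≤ 1 / 10 ^ 10) (hr : 0 < r) (hrD : Real.log D / δ ≤ r ^ 2 * D) :
    6 * D ^ 3 * Real.exp (-(D * min r (r ^ 2 / p) / 16)) ≤ δ := by
  have hD0 : 0 < D := by linarith
  set y : ℝ := (√δ)⁻¹ with hy
  have hsδ : 0 < √δ := Real.sqrt_pos.mpr hδ
  have hy0 : 0 < y := inv_pos.mpr hsδ
  have hy2 : y ^ 2 = δ⁻¹ := by rw [hy, inv_pow, Real.sq_sqrt hδ.le]
  have hy1 : 1 ≤ y := by
    rw [hy]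
    exact (one_le_inv₀ hsδ).mpr (Real.sqrt_le_one.mpr hδ1)
  set L := Real.log D with hL
  have hL1 : 1 ≤ L := by
    rw [hL, Real.le_log_iff_exp_le hD0]
    linarith [Real.exp_one_lt_d9]
  have hLD : L ≤ 2 * √D := by
    have h := Real.log_le_self (Real.sqrt_nonneg D)
    rw [Real.log_sqrt hD0.le] at h
    linarith
  have hsD : 10 ^ 5 ≤ √D := Real.le_sqrt_of_sq_le (by linarith)
  have hD2 : √D ^ 2 = D := Real.sq_sqrt hD0.le
  have hrD' : L * y ^ 2 ≤ r ^ 2 * D := by rw [hy2]; exact hrD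
  -- The constant `10 ^ 10` enters twice: `log D ≤ 2 * √D` and `√D ≥ 10 ^ 5` give `128 ^ 2 * L ≤ D`
  -- for the first branch of the minimum; `128 * p ≤ 1` serves the second.
  have hmain : 128 * L * y ≤ D * min r (r ^ 2 / p) := by
    rw [mul_min_of_nonneg _ _ hD0.le, le_min_iff]
    constructor
    · refine le_of_pow_le_pow_left₀ two_ne_zero (by positivity) ?_
      have h1 : 128 ^ 2 * L ≤ D := by nlinarith
      calc (128 * L * y) ^ 2 = (128 ^ 2 * L) * (L * y ^ 2) := by ring
        _ ≤ D * (r ^ 2 * D) := mul_le_mul h1 hrD' (by positivity) hD0.le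
        _ = (D * r) ^ 2 := by ring
    · rw [← mul_div_assoc, le_div_iff₀ hp]
      have : L * y ≤ L * y ^ 2 :=
        mul_le_mul_of_nonneg_left (le_self_pow₀ hy1 two_ne_zero) (by linarith)
      nlinarith [mul_pos (by linarith : 0 < L) hy0]
  have h8 : -(D * min r (r ^ 2 / p) / 16) ≤ -(4 * L) + -(2 * y) := by nlinarith
  have hexpL : Real.exp (-(4 * L)) = (D ^ 4)⁻¹ := by
    rw [Real.exp_neg, mul_comm, Real.exp_mul, hL, Real.exp_log hD0]
    norm_cast
  have hexpy : Real.exp (-(2 * y)) ≤ δ := by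
    rw [Real.exp_neg, inv_le_comm₀ (Real.exp_pos _) hδ, ← hy2, two_mul, Real.exp_add, sq]
    have := Real.add_one_le_exp y
    exact mul_le_mul (by linarith) (by linarith) hy0.le (Real.exp_pos _).le
  calc 6 * D ^ 3 * Real.exp (-(D * min r (r ^ 2 / p) / 16))
      ≤ 6 * D ^ 3 * (Real.exp (-(4 * L)) * Real.exp (-(2 * y))) := by
        rw [← Real.exp_add]
        gcongr
    _ ≤ 6 * D ^ 3 * ((D ^ 4)⁻¹ * δ) := by rw [hexpL]; gcongr
    _ = 6 / D * δ := by field_simp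
    _ ≤ 1 * δ := by
        gcongr
        rw [div_le_one hD0]; linarith
    _ = δ := one_mul δ

end Numerics

/-! ### Matrix elements of randomly rotated projections. -/

section RandomDecomposition

variable {V : Type u} [NormedAddCommGroup V] [InnerProductSpace ℂ V]

/-- Finitely many unit vectors whose quadratic forms control all matrix elements. -/
lemma exists_testVectors {D : ℕ} (φ : OrthonormalBasis (Fin D) ℂ V) :
    ∃ χ : Fin D × Fin D × Fin 3 → V, (∀ j, ‖χ j‖ = 1) ∧
      ∀ (M : V →L[ℂ] V), (M : V →ₗ[ℂ] V).IsSymmetric → ∀ p r : ℝ,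
        (∀ j, ‖inner ℂ (χ j) (M (χ j)) - p‖ ≤ r) →
        (∀ α, ‖inner ℂ (φ α) (M (φ α)) - p‖ ≤ r) ∧
          ∀ α β, α ≠ β → ‖inner ℂ (φ α) (M (φ β))‖ ^ 2 ≤ 8 * r ^ 2 := by
  -- Polarization: once the diagonal elements are known, `c = 1` detects the real part of an
  -- off-diagonal element and `c = I` the imaginary part, each up to `2 * r`; hence `8 * r ^ 2`.
  set v : ℂ → Fin D → Fin D → V := fun c α β => ((√2 : ℝ) : ℂ)⁻¹ • (φ α + c • φ β) with hv
  have h2 : (((√2 : ℝ) : ℂ)⁻¹) * ((√2 : ℝ) : ℂ)⁻¹ = 1 / 2 := by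
    rw [← mul_inv, ← Complex.ofReal_mul, Real.mul_self_sqrt (by norm_num)]
    norm_num
  have hq : ∀ (M : V →L[ℂ] V) c α β, inner ℂ (v c α β) (M (v c α β)) =
      1 / 2 * (inner ℂ (φ α) (M (φ α)) + c * inner ℂ (φ α) (M (φ β)) +
        starRingEnd ℂ c * inner ℂ (φ β) (M (φ α)) +
        starRingEnd ℂ c * c * inner ℂ (φ β) (M (φ β))) := by
    intro M c α β
    simp only [hv, map_smul, map_add, inner_smul_left, inner_smul_right, inner_add_left,
      inner_add_right, map_inv₀, Complex.conj_ofReal]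
    rw [← h2]
    ring
  have hunit : ∀ c α β, starRingEnd ℂ c * c = 1 → α ≠ β → ‖v c α β‖ = 1 := by
    intro c α β hc hne
    have h := hq 1 c α β
    simp only [one_apply_eq_self, hc, inner_self_eq_norm_sq_to_K, φ.orthonormal.1 α,
      φ.orthonormal.1 β, φ.orthonormal.2 hne, φ.orthonormal.2 hne.symm] at h
    have h' : ((‖v c α β‖ : ℝ) : ℂ) ^ 2 = 1 := by
      exact h.trans (by norm_num)
    have h' : ‖v c α β‖ ^ 2 = 1 := by exact_mod_cast h'
    nlinarith [norm_nonneg (v c α β), sq_nonneg (‖v c α β‖ - 1)]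
  have hbound : ∀ (M : V →L[ℂ] V), (M : V →ₗ[ℂ] V).IsSymmetric → ∀ (p r : ℝ) (c : ℂ) α β,
      starRingEnd ℂ c * c = 1 → ‖inner ℂ (φ α) (M (φ α)) - p‖ ≤ r →
      ‖inner ℂ (φ β) (M (φ β)) - p‖ ≤ r → ‖inner ℂ (v c α β) (M (v c α β)) - p‖ ≤ r →
      |(c * inner ℂ (φ α) (M (φ β))).re| ≤ 2 * r := by
    intro M hM p r c α β hc hα hβ hαβ
    have hsymm : inner ℂ (φ β) (M (φ α)) = starRingEnd ℂ (inner ℂ (φ α) (M (φ β))) := by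
      rw [inner_conj_symm]
      exact (hM (φ β) (φ α)).symm
    have h1 : ((2 * (c * inner ℂ (φ α) (M (φ β))).re : ℝ) : ℂ) =
        2 * (inner ℂ (v c α β) (M (v c α β)) - p) - (inner ℂ (φ α) (M (φ α)) - p) -
          (inner ℂ (φ β) (M (φ β)) - p) := by
      rw [hq, hc, hsymm, ← map_mul, Complex.ofReal_mul, Complex.re_eq_add_conj, map_mul]
      push_cast
      ring
    have h3 : ‖((2 * (c * inner ℂ (φ α) (M (φ β))).re : ℝ) : ℂ)‖ ≤ 2 * r + r + r := by
      rw [h1]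
      refine (norm_sub_le _ _).trans (add_le_add ((norm_sub_le _ _).trans
        (add_le_add ?_ hα)) hβ)
      rw [norm_mul, Complex.norm_ofNat]
      linarith
    rw [Complex.norm_real, Real.norm_eq_abs, abs_mul, abs_two] at h3
    linarith
  -- For `α = β` the vectors `v c α β` need not be normalised, so `φ α` takes their place.
  refine ⟨fun j => if j.1 = j.2.1 then φ j.1 else
    ![φ j.1, v 1 j.1 j.2.1, v Complex.I j.1 j.2.1] j.2.2, ?_, ?_⟩
  · rintro ⟨α, β, k⟩
    by_cases h : α = β
    · simp [h, φ.orthonormal.1]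
    · simp only [h, if_false]
      fin_cases k
      · exact φ.orthonormal.1 α
      · exact hunit 1 α β (by simp) h
      · exact hunit Complex.I α β (by simp) h
  · intro M hM p r hj
    have hdiag : ∀ α, ‖inner ℂ (φ α) (M (φ α)) - p‖ ≤ r := fun α => by
      simpa using hj (α, α, 0)
    refine ⟨hdiag, fun α β hne => ?_⟩
    have h1 := hbound M hM p r 1 α β (by simp) (hdiag α) (hdiag β)
      (by simpa [hne] using hj (α, β, 1))
    have hI := hbound M hM p r Complex.I α β (by simp) (hdiag α) (hdiag β)
      (by simpa [hne] using hj (α, β, 2))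
    rw [one_mul] at h1
    simp only [Complex.mul_re, Complex.I_re, Complex.I_im, zero_mul, one_mul, zero_sub,
      abs_neg] at hI
    rw [← Complex.normSq_eq_norm_sq, Complex.normSq_apply]
    have h1' := sq_le_sq' (abs_le.mp h1).1 (abs_le.mp h1).2
    have hI' := sq_le_sq' (abs_le.mp hI).1 (abs_le.mp hI).2
    nlinarith

namespace OrthDecomp

variable [FiniteDimensional ℂ V] {n : ℕ} {d : Fin n → ℕ}

lemma isSymmetric_proj (𝒟 : OrthDecomp V d) (ν : Fin n) :
    (𝒟.proj ν : V →ₗ[ℂ] V).IsSymmetric :=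
  Submodule.starProjection_isSymmetric _

lemma rotate_proj_apply [CompleteSpace V] (𝒟 : OrthDecomp V d) (U : unitary (V →L[ℂ] V))
    (ν : Fin n) (x : V) :
    (𝒟.rotate U).proj ν x = (U : V →L[ℂ] V) (𝒟.proj ν (star (U : V →L[ℂ] V) x)) :=
  Submodule.starProjection_map_apply (Unitary.linearIsometryEquiv U) (𝒟.space ν) x

/-- Moves the randomness from the decomposition to the vector, where the sphere estimate applies. -/
lemma inner_rotate_proj [CompleteSpace V] (𝒟 : OrthDecomp V d) (U : unitary (V →L[ℂ] V))
    (ν : Fin n) (x : V) :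
    inner ℂ x ((𝒟.rotate U).proj ν x) =
      inner ℂ (star (U : V →L[ℂ] V) x) (𝒟.proj ν (star (U : V →L[ℂ] V) x)) := by
  rw [rotate_proj_apply, ContinuousLinearMap.star_eq_adjoint,
    ContinuousLinearMap.adjoint_inner_left]

lemma ofBasis_proj_apply (b : OrthonormalBasis ((ν : Fin n) × Fin (d ν)) ℂ V) (ν : Fin n) (x : V) :
    (ofBasis b).proj ν x = ∑ i, inner ℂ (b ⟨ν, i⟩) x • b ⟨ν, i⟩ := by
  refine (Submodule.eq_starProjection_of_mem_of_inner_eq_zero ?_ ?_)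
  · exact Submodule.sum_mem _ fun i _ => Submodule.smul_mem _ _
      (Submodule.subset_span (Set.mem_range_self i))
  · intro w hw
    refine Submodule.span_induction (p := fun w _ =>
      inner ℂ (x - ∑ i, inner ℂ (b ⟨ν, i⟩) x • b ⟨ν, i⟩) w = 0) ?_ (inner_zero_right _) ?_ ?_ hw
    · rintro _ ⟨j, rfl⟩
      simp only [inner_sub_left, sum_inner, inner_smul_left, inner_conj_symm]
      rw [Finset.sum_eq_single j]
      · simp
      · intro i _ hij
        rw [b.orthonormal.2 (by simpa using hij), mul_zero]
      · simp
    · intro y z _ _ hy hz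
      rw [inner_add_right, hy, hz, add_zero]
    · intro c y _ hy
      rw [inner_smul_right, hy, mul_zero]

lemma filter_fst_eq (ν : Fin n) :
    Finset.univ.filter (fun j : (ν : Fin n) × Fin (d ν) => j.1 = ν) =
      Finset.univ.map (Function.Embedding.sigmaMk ν) := by
  ext ⟨μ, i⟩
  simp only [Finset.mem_filter, Finset.mem_univ, true_and, Finset.mem_map,
    Function.Embedding.sigmaMk_apply]
  constructor
  · rintro rfl
    exact ⟨i, rfl⟩
  · rintro ⟨i', h⟩
    exact (congrArg Sigma.fst h).symm

lemma inner_ofBasis_proj (b : OrthonormalBasis ((ν : Fin n) × Fin (d ν)) ℂ V) (ν : Fin n) (x : V) :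
    inner ℂ x ((ofBasis b).proj ν x) =
      ((∑ j ∈ Finset.univ.filter (fun j : (ν : Fin n) × Fin (d ν) => j.1 = ν),
        ‖inner ℂ (b j) x‖ ^ 2 : ℝ) : ℂ) := by
  rw [filter_fst_eq, Finset.sum_map, ofBasis_proj_apply, inner_sum, Complex.ofReal_sum]
  refine Finset.sum_congr rfl fun i _ => ?_
  rw [inner_smul_right, ← inner_conj_symm x, Complex.mul_conj, Complex.normSq_eq_norm_sq]
  rfl

end OrthDecomp

/-- Uniform bounds on the matrix elements bound `maxDeviation`. -/
lemma maxDeviation_le [FiniteDimensional ℂ V] {n D : ℕ} {d : Fin n → ℕ}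
    (φ : OrthonormalBasis (Fin D) ℂ V) (𝒟 : OrthDecomp V d) (ν : Fin n) {x y : ℝ}
    (hx : 0 ≤ x) (hy : 0 ≤ y)
    (hoff : ∀ α β, α ≠ β → ‖inner ℂ (φ α) (𝒟.proj ν (φ β))‖ ^ 2 ≤ x)
    (hdiag : ∀ α, ‖inner ℂ (φ α) (𝒟.proj ν (φ α)) - (d ν / D : ℂ)‖ ^ 2 ≤ y) :
    maxDeviation φ 𝒟 ν ≤ x + y :=
  add_le_add (Real.iSup_le (fun p => hoff _ _ p.2) hx) (Real.iSup_le hdiag hy)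

lemma haarUnitary_not_smallDeviation_le [CompleteSpace V] [FiniteDimensional ℂ V] {ε δ δ' : ℝ}
    (hε : 0 < ε) (hδ : 0 < δ) (hδ1 : δ ≤ 1) (hδ' : 0 < δ') {D n : ℕ} {d : Fin n → ℕ}
    (hd : ∑ ν, d ν = Module.finrank ℂ V) (φ : OrthonormalBasis (Fin D) ℂ V)
    (hdν : ∀ ν, max (10 ^ 10) (10 * (n : ℝ) ^ 2 / (ε ^ 2 * δ' * δ)) * Real.log D < d ν ∧
      (d ν : ℝ) < D / 10 ^ 10) :
    haarUnitary V {U | ¬ SmallDeviation φ ((OrthDecomp.standard hd).rotate U) ε δ'} ≤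
      ENNReal.ofReal δ := by
  classical
  have hD : Module.finrank ℂ V = D := by
    simpa using Module.finrank_eq_card_basis φ.toBasis
  have hdpos : ∀ ν, 1 ≤ d ν := by
    intro ν
    have h : (0 : ℝ) < d ν := lt_of_le_of_lt
      (mul_nonneg (le_max_of_le_left (by norm_num)) (Real.log_natCast_nonneg D)) (hdν ν).1
    exact_mod_cast h
  have hnD : n ≤ D := by
    rw [← hD, ← hd]
    simpa using Finset.sum_le_sum fun ν (_ : ν ∈ Finset.univ) => hdpos ν
  obtain ⟨χ, hχ, hχM⟩ := exists_testVectors φ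
  have hν : ∀ ν, haarUnitary V {U | ¬ maxDeviation φ ((OrthDecomp.standard hd).rotate U) ν <
      ε ^ 2 * (d ν / (n * D)) * (δ' / n)} ≤ ENNReal.ofReal (δ / n) := by
    intro ν
    have hn0 : (0 : ℝ) < n := by exact_mod_cast (Fin.pos ν)
    have hnD' : (n : ℝ) ≤ D := by exact_mod_cast hnD
    have hD0 : (0 : ℝ) < D := hn0.trans_le hnD'
    have hd1 : (1 : ℝ) ≤ d ν := by exact_mod_cast hdpos ν
    have hdlt := (hdν ν).2
    have hD10 : (10 : ℝ) ^ 10 ≤ D := by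
      have := (lt_div_iff₀ (by norm_num)).mp hdlt
      linarith
    set s : ℝ := ε ^ 2 * (d ν / (n * D)) * (δ' / n) with hs
    have hs0 : 0 < s := by positivity
    set p : ℝ := d ν / D with hp
    have hp0 : 0 < p := by positivity
    have hpD : p ≤ 1 / 10 ^ 10 := by
      rw [hp, div_le_div_iff₀ hD0 (by norm_num), one_mul]
      exact ((lt_div_iff₀ (by norm_num)).mp hdlt).le
    -- Off-diagonal elements cost `8 * r ^ 2` and diagonal ones `r ^ 2`; the total `9 * r ^ 2` stays
    -- strictly below `s`. The same `10` appears in the lower bound on `d ν`, which becomes `hrD`.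
    set r : ℝ := √(s / 10) with hr
    have hr0 : 0 < r := Real.sqrt_pos.mpr (by positivity)
    have hr2 : r ^ 2 = s / 10 := Real.sq_sqrt (by positivity)
    have hrD : Real.log D / δ ≤ r ^ 2 * D := by
      have h := (mul_le_mul_of_nonneg_right (le_max_right (10 ^ 10) _)
        (Real.log_natCast_nonneg D)).trans (hdν ν).1.le
      rw [div_mul_eq_mul_div, div_le_iff₀ (by positivity)] at h
      rw [hr2, hs, div_le_iff₀ hδ]
      have : ε ^ 2 * (d ν / (n * D)) * (δ' / n) / 10 * D * δ =
          (d ν * (ε ^ 2 * δ' * δ)) / (10 * n ^ 2) := by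
        field_simp
      rw [this, le_div_iff₀ (by positivity)]
      linarith
    -- The largest `m` with `m ≤ r` and `m * p ≤ r ^ 2`.
    set m : ℝ := min r (r ^ 2 / p) with hm
    have hm0 : 0 ≤ m := by positivity
    have hmp : m * p ≤ r ^ 2 := by
      rw [← le_div_iff₀ hp0]
      exact min_le_right _ _
    have hcard : Fintype.card ((ν : Fin n) × Fin (d ν)) = D := by
      rw [← hD, ← hd]; simp
    set S : Finset ((ν : Fin n) × Fin (d ν)) := Finset.univ.filter fun j => j.1 = ν with hS
    have hScard : (S.card : ℝ) = p * Fintype.card ((ν : Fin n) × Fin (d ν)) := by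
      have : S = Finset.univ.map (Function.Embedding.sigmaMk ν) := OrthDecomp.filter_fst_eq ν
      rw [hcard, hp, div_mul_cancel₀ _ hD0.ne', this]
      simp
    set b : OrthonormalBasis ((ν : Fin n) × Fin (d ν)) ℂ V := (stdOrthonormalBasis ℂ V).reindex
      ((finCongr hd.symm).trans finSigmaFinEquiv.symm) with hb
    set B : Fin D × Fin D × Fin 3 → Set (unitary (V →L[ℂ] V)) := fun j =>
      {U | r ≤ |∑ i ∈ S, ‖inner ℂ (b i) (star (U : V →L[ℂ] V) (χ j))‖ ^ 2 - p|} with hB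
    have hBj : ∀ j, haarUnitary V (B j) ≤ ENNReal.ofReal (2 * Real.exp (-(D * m / 16))) := by
      intro j
      have h := haarUnitary_abs_weight_deviation_le b S hScard hp0.le
        (hpD.trans (by norm_num)) hr0 hm0 (min_le_left _ _) hmp (hχ j)
      rwa [hcard] at h
    have hsub : {U | ¬ maxDeviation φ ((OrthDecomp.standard hd).rotate U) ν < s} ⊆ ⋃ j, B j := by
      intro U hU
      by_contra hcon
      refine hU ?_
      have hj : ∀ j, ‖inner ℂ (χ j) (((OrthDecomp.standard hd).rotate U).proj ν (χ j)) - (p : ℂ)‖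
          ≤ r := by
        intro j
        have h : ¬ r ≤ |∑ i ∈ S, ‖inner ℂ (b i) (star (U : V →L[ℂ] V) (χ j))‖ ^ 2 - p| :=
          fun h => hcon (Set.mem_iUnion.mpr ⟨j, h⟩)
        rw [OrthDecomp.inner_rotate_proj, OrthDecomp.standard, OrthDecomp.inner_ofBasis_proj,
          ← Complex.ofReal_sub, Complex.norm_real]
        exact (not_le.mp h).le
      obtain ⟨hdiag, hoff⟩ := hχM _ (OrthDecomp.isSymmetric_proj _ ν) p r hj
      have := maxDeviation_le φ ((OrthDecomp.standard hd).rotate U) ν (x := 8 * r ^ 2) (y := r ^ 2)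
        (by positivity) (by positivity) hoff (fun α => by
          have h := hdiag α
          rw [hp, Complex.ofReal_div, Complex.ofReal_natCast, Complex.ofReal_natCast] at h
          exact pow_le_pow_left₀ (norm_nonneg _) h 2)
      linarith
    refine (measure_mono hsub).trans ((measure_iUnion_fintype_le _ _).trans
      ((Finset.sum_le_sum fun j _ => hBj j).trans ?_))
    rw [Finset.sum_const, nsmul_eq_mul, ← ENNReal.ofReal_natCast,
      ← ENNReal.ofReal_mul (by positivity)]
    refine ENNReal.ofReal_le_ofReal ?_
    have hnum := six_mul_cube_mul_exp_le hD10 hδ hδ1 hp0 hpD hr0 hrD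
    rw [le_div_iff₀ hn0]
    refine le_trans ?_ hnum
    simp only [Finset.card_univ, Fintype.card_prod, Fintype.card_fin]
    push_cast
    calc (D : ℝ) * (D * 3) * (2 * Real.exp (-(D * m / 16))) * n
        ≤ (D : ℝ) * (D * 3) * (2 * Real.exp (-(D * m / 16))) * D := by gcongr
      _ = _ := by ring
  have hsub : {U | ¬ SmallDeviation φ ((OrthDecomp.standard hd).rotate U) ε δ'} ⊆
      ⋃ ν, {U | ¬ maxDeviation φ ((OrthDecomp.standard hd).rotate U) ν <
        ε ^ 2 * (d ν / (n * D)) * (δ' / n)} := by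
    intro U hU
    obtain ⟨ν, hν⟩ := not_forall.mp (show ¬ SmallDeviation _ _ _ _ from hU)
    exact Set.mem_iUnion.mpr ⟨ν, hν⟩
  refine (measure_mono hsub).trans ((measure_iUnion_fintype_le _ _).trans
    ((Finset.sum_le_sum fun ν _ => hν ν).trans ?_))
  rw [Finset.sum_const, nsmul_eq_mul, ← ENNReal.ofReal_natCast,
    ← ENNReal.ofReal_mul (by positivity)]
  refine ENNReal.ofReal_le_ofReal ?_
  rw [Finset.card_univ, Fintype.card_fin]
  rcases eq_or_ne (n : ℝ) 0 with h | h
  · rw [h, zero_mul]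
    exact hδ.le
  · rw [mul_div_cancel₀ _ h]

/-- A uniformly distributed decomposition into spaces of moderate dimensions has small deviations
with high probability. -/
lemma uniformDecomp_smallDeviation [CompleteSpace V] [FiniteDimensional ℂ V] {ε δ δ' : ℝ}
    (hε : 0 < ε) (hδ : 0 < δ) (hδ' : 0 < δ') {D n : ℕ} {d : Fin n → ℕ}
    (hd : ∑ ν, d ν = Module.finrank ℂ V) (φ : OrthonormalBasis (Fin D) ℂ V)
    (hdν : ∀ ν, max (10 ^ 10) (10 * (n : ℝ) ^ 2 / (ε ^ 2 * δ' * δ)) * Real.log D < d ν ∧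
      (d ν : ℝ) < D / 10 ^ 10) :
    1 - δ ≤ (uniformDecomp hd).real {𝒟 | SmallDeviation φ 𝒟 ε δ'} := by
  rcases le_or_gt δ 1 with hδ1 | hδ1
  swap
  · exact (sub_nonpos.mpr hδ1.le).trans measureReal_nonneg
  have : IsProbabilityMeasure (haarUnitary V) := ⟨Measure.haarMeasure_self (K₀ := ⊤)⟩
  set G : Set (unitary (V →L[ℂ] V)) :=
    {U | SmallDeviation φ ((OrthDecomp.standard hd).rotate U) ε δ'} with hG
  have hbad : (haarUnitary V).real Gᶜ ≤ δ :=
    ENNReal.toReal_le_of_le_ofReal hδ.le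
      (haarUnitary_not_smallDeviation_le hε hδ hδ1 hδ' hd φ hdν)
  -- This inequality for push-forwards, like the subadditivity in `hunion`, requires no
  -- measurability of the event.
  have hgood : (haarUnitary V).real G ≤ (uniformDecomp hd).real {𝒟 | SmallDeviation φ 𝒟 ε δ'} :=
    ENNReal.toReal_mono (measure_ne_top _ _)
      (Measure.le_map_apply (measurable_rotate _).aemeasurable _)
  have hunion := measureReal_union_le (μ := haarUnitary V) G Gᶜ
  rw [Set.union_compl_self, probReal_univ] at hunion
  linarith

end RandomDecomposition

/-! ### Long-time averages: Parseval and Markov. -/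

section TimeAverage

lemma tendsto_average_exp_mul_I (ω : ℝ) :
    Tendsto (fun T : ℝ => (T : ℂ)⁻¹ * ∫ t in (0 : ℝ)..T, Complex.exp ((ω : ℂ) * Complex.I * t))
      atTop (𝓝 (if ω = 0 then 1 else 0)) := by
  split_ifs with h
  · refine tendsto_const_nhds.congr' ?_
    filter_upwards [eventually_gt_atTop 0] with T hT
    have : (T : ℂ) ≠ 0 := by exact_mod_cast hT.ne'
    simp [h, this]
  · have hω : (ω : ℂ) * Complex.I ≠ 0 := mul_ne_zero (by exact_mod_cast h) Complex.I_ne_zero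
    refine squeeze_zero_norm' (a := fun T : ℝ => T⁻¹ * (2 / |ω|)) ?_ ?_
    · filter_upwards [eventually_gt_atTop 0] with T hT
      rw [integral_exp_mul_complex hω, norm_mul, norm_inv, Complex.norm_real, Real.norm_eq_abs,
        abs_of_pos hT]
      have h1 : ‖Complex.exp ((ω : ℂ) * Complex.I * T)‖ = 1 := by
        have := Complex.norm_exp_ofReal_mul_I (ω * T)
        rwa [Complex.ofReal_mul, mul_right_comm] at this
      have h2 : ‖Complex.exp ((ω : ℂ) * Complex.I * T) -
          Complex.exp ((ω : ℂ) * Complex.I * (0 : ℝ))‖ ≤ 2 := by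
        refine (norm_sub_le _ _).trans ?_
        rw [h1]
        norm_num
      rw [norm_div, norm_mul, Complex.norm_real, Complex.norm_I, mul_one, Real.norm_eq_abs]
      gcongr
    · simpa using tendsto_inv_atTop_zero.mul_const (2 / |ω|)

/-- Parseval's identity for trigonometric polynomials with distinct real frequencies. -/
lemma tendsto_average_norm_sq {κ : Type*} [Fintype κ] (a : κ → ℂ) {ω : κ → ℝ}
    (hω : Function.Injective ω) :
    Tendsto (fun T : ℝ => T⁻¹ * ∫ t in (0 : ℝ)..T,
        ‖∑ i, a i * Complex.exp ((ω i : ℂ) * Complex.I * t)‖ ^ 2)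
      atTop (𝓝 (∑ i, ‖a i‖ ^ 2)) := by
  classical
  have hexp : ∀ t : ℝ, ((‖∑ i, a i * Complex.exp ((ω i : ℂ) * Complex.I * t)‖ ^ 2 : ℝ) : ℂ) =
      ∑ i, ∑ j, a i * starRingEnd ℂ (a j) *
        Complex.exp (((ω i - ω j : ℝ) : ℂ) * Complex.I * t) := by
    intro t
    rw [Complex.ofReal_pow, ← Complex.mul_conj', map_sum, Finset.sum_mul_sum]
    refine Finset.sum_congr rfl fun i _ => Finset.sum_congr rfl fun j _ => ?_
    rw [map_mul, ← Complex.exp_conj, mul_mul_mul_comm, ← Complex.exp_add]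
    congr 2
    simp only [map_mul, Complex.conj_ofReal, Complex.conj_I]
    push_cast
    ring
  have hlim : Tendsto (fun T : ℝ => ∑ i, ∑ j, a i * starRingEnd ℂ (a j) * ((T : ℂ)⁻¹ *
      ∫ t in (0 : ℝ)..T, Complex.exp (((ω i - ω j : ℝ) : ℂ) * Complex.I * t))) atTop
      (𝓝 (∑ i, ∑ j, a i * starRingEnd ℂ (a j) * (if ω i - ω j = 0 then 1 else 0))) :=
    tendsto_finsetSum _ fun i _ => tendsto_finsetSum _ fun j _ =>
      (tendsto_average_exp_mul_I _).const_mul _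
  have hval : ∑ i, ∑ j, a i * starRingEnd ℂ (a j) * (if ω i - ω j = 0 then 1 else 0) =
      ((∑ i, ‖a i‖ ^ 2 : ℝ) : ℂ) := by
    rw [Complex.ofReal_sum]
    refine Finset.sum_congr rfl fun i _ => ?_
    rw [Finset.sum_eq_single i]
    · simp [Complex.mul_conj']
    · intro j _ hji
      rw [if_neg, mul_zero]
      exact fun h => hji (hω (sub_eq_zero.mp h)).symm
    · simp
  rw [hval] at hlim
  have hre := (Complex.continuous_re.tendsto _).comp hlim
  rw [Complex.ofReal_re] at hre
  refine hre.congr fun T => ?_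
  have hint : ∀ c : ℂ, ∀ w : ℝ, IntervalIntegrable
      (fun t : ℝ => c * Complex.exp ((w : ℂ) * Complex.I * t)) volume 0 T := fun c w =>
    Continuous.intervalIntegrable (by fun_prop) _ _
  have h : ((T⁻¹ * ∫ t in (0 : ℝ)..T,
      ‖∑ i, a i * Complex.exp ((ω i : ℂ) * Complex.I * t)‖ ^ 2 : ℝ) : ℂ) =
      ∑ i, ∑ j, a i * starRingEnd ℂ (a j) * ((T : ℂ)⁻¹ *
      ∫ t in (0 : ℝ)..T, Complex.exp (((ω i - ω j : ℝ) : ℂ) * Complex.I * t)) := by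
    rw [Complex.ofReal_mul, ← intervalIntegral.integral_ofReal]
    simp only [hexp]
    rw [intervalIntegral.integral_finsetSum fun i _ =>
      Continuous.intervalIntegrable (by fun_prop) _ _, Finset.mul_sum, Complex.ofReal_inv]
    refine Finset.sum_congr rfl fun i _ => ?_
    rw [intervalIntegral.integral_finsetSum fun j _ => hint _ _, Finset.mul_sum]
    refine Finset.sum_congr rfl fun j _ => ?_
    rw [intervalIntegral.integral_const_mul]
    ring
  rw [Function.comp_apply, ← h, Complex.ofReal_re]

/-- Markov's inequality for long-time averages. -/
lemma mostTimes_of_tendsto_average {g : ℝ → ℝ} (hg : Continuous g) (hg0 : ∀ t, 0 ≤ g t) {L δ : ℝ}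
    (hL : Tendsto (fun T : ℝ => T⁻¹ * ∫ t in (0 : ℝ)..T, g t) atTop (𝓝 L)) (hLδ : L ≤ δ)
    {p : ℝ → Prop} (hp : ∀ t, g t < 1 → p t) : MostTimes δ p := by
  have hlim : Tendsto (fun T : ℝ => 1 - T⁻¹ * ∫ t in (0 : ℝ)..T, g t) atTop (𝓝 (1 - L)) :=
    hL.const_sub 1
  have hfin : ∀ (T : ℝ) (q : ℝ → Prop), volume {t | t ∈ Set.Ioc 0 T ∧ q t} ≠ ⊤ := fun T q =>
    ((measure_mono fun t ht => ht.1).trans_lt measure_Ioc_lt_top).ne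
  have hle : ∀ T : ℝ, 0 < T →
      1 - T⁻¹ * ∫ t in (0 : ℝ)..T, g t ≤ volume.real {t | t ∈ Set.Ioc 0 T ∧ p t} / T := by
    intro T hT
    have hmarkov : volume.real {t | t ∈ Set.Ioc 0 T ∧ 1 ≤ g t} ≤ ∫ t in (0 : ℝ)..T, g t := by
      rw [intervalIntegral.integral_of_le hT.le]
      have h := mul_meas_ge_le_integral_of_nonneg (μ := volume.restrict (Set.Ioc 0 T))
        (ae_of_all _ hg0) (hg.integrableOn_Ioc (a := 0) (b := T)) 1
      rw [one_mul, measureReal_restrict_apply (measurableSet_le measurable_const hg.measurable)] at h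
      refine le_trans (le_of_eq ?_) h
      congr 1
      ext t
      exact and_comm
    -- The set where `p` holds may be non-measurable; subadditivity of outer measure suffices.
    have hcover : T ≤ volume.real {t | t ∈ Set.Ioc 0 T ∧ p t} +
        volume.real {t | t ∈ Set.Ioc 0 T ∧ 1 ≤ g t} := by
      refine le_trans ?_ (measureReal_union_le _ _)
      have h : volume.real (Set.Ioc 0 T) = T := by
        rw [Real.volume_real_Ioc_of_le hT.le, sub_zero]
      rw [← h]
      refine measureReal_mono (fun t ht => ?_) (measure_union_ne_top (hfin _ _) (hfin _ _))
      rw [h] at *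
      rcases lt_or_ge (g t) 1 with h1 | h1
      · exact Or.inl ⟨ht, hp t h1⟩
      · exact Or.inr ⟨ht, h1⟩
    rw [le_div_iff₀ hT, sub_mul, one_mul, mul_comm T⁻¹, mul_assoc, inv_mul_cancel₀ hT.ne', mul_one]
    linarith
  have hbdd : ∀ᶠ T : ℝ in atTop, volume.real {t | t ∈ Set.Ioc 0 T ∧ p t} / T ≤ 1 := by
    filter_upwards [eventually_gt_atTop 0] with T hT
    rw [div_le_one hT]
    have h : volume.real (Set.Ioc 0 T) = T := by
      rw [Real.volume_real_Ioc_of_le hT.le, sub_zero]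
    exact (measureReal_mono (fun t ht => ht.1) measure_Ioc_lt_top.ne).trans h.le
  -- A real `liminf` can be compared only under boundedness, here from fractions being at most `1`.
  have hcob : IsCoboundedUnder (· ≥ ·) atTop
      fun T : ℝ => volume.real {t | t ∈ Set.Ioc 0 T ∧ p t} / T :=
    (isBoundedUnder_of_eventually_le hbdd).isCoboundedUnder_ge
  unfold MostTimes
  calc 1 - δ ≤ 1 - L := by linarith
    _ = liminf (fun T : ℝ => 1 - T⁻¹ * ∫ t in (0 : ℝ)..T, g t) atTop := hlim.liminf_eq.symm
    _ ≤ _ := by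
      refine liminf_le_liminf ?_ hlim.isBoundedUnder_ge hcob
      filter_upwards [eventually_gt_atTop 0] with T hT using hle T hT

end TimeAverage

/-! ### Fourier expansion of expectation values in time. -/

section Dynamics

variable {V : Type u} [NormedAddCommGroup V] [InnerProductSpace ℂ V]

lemma exp_apply_of_eigenvector [CompleteSpace V] {A : V →L[ℂ] V} {v : V} {a : ℂ}
    (h : A v = a • v) : NormedSpace.exp A v = Complex.exp a • v := by
  have hpow : ∀ k : ℕ, (A ^ k) v = a ^ k • v := by
    intro k
    induction k with
    | zero => simp
    | succ k ih => rw [pow_succ, mul_apply_eq_comp, h, map_smul, ih, smul_smul, pow_succ, mul_comm]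
  have h1 := (NormedSpace.exp_series_hasSum_exp' (𝕂 := ℂ) A).mapL
    (ContinuousLinearMap.apply ℂ V v)
  have h2 := (NormedSpace.exp_series_hasSum_exp' (𝕂 := ℂ) a).smul_const v
  rw [← Complex.exp_eq_exp_ℂ] at h2
  refine h1.unique ?_
  convert h2 using 2 with k
  rw [ContinuousLinearMap.apply_apply, smul_apply, hpow, smul_assoc]

variable {D : ℕ} {H : V →L[ℂ] V} {E : Fin D → ℝ} {φ : OrthonormalBasis (Fin D) ℂ V}

lemma evolve_eq_sum [CompleteSpace V] (hH : IsEigenbasis H E φ) (ħ : ℝ) (ψ₀ : V) (t : ℝ) :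
    evolve ħ H ψ₀ t =
      ∑ α, (Complex.exp (-(Complex.I * t / ħ) * E α) * inner ℂ (φ α) ψ₀) • φ α := by
  unfold evolve
  conv_lhs => rw [← φ.sum_repr' ψ₀]
  rw [map_sum]
  refine Finset.sum_congr rfl fun α _ => ?_
  rw [map_smul, exp_apply_of_eigenvector (a := -(Complex.I * t / ħ) * E α), smul_smul, mul_comm]
  rw [smul_apply, hH α, smul_smul]

/-- The frequencies of the expectation values: `0` for the collected diagonal terms, and one for
each off-diagonal matrix element. -/
noncomputable def frequency (ħ : ℝ) (E : Fin D → ℝ) : Option {p : Fin D × Fin D // p.1 ≠ p.2} → ℝ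
  | none => 0
  | some p => (E p.1.1 - E p.1.2) / ħ

/-- The Fourier coefficients of `t ↦ ⟨ψ_t|M|ψ_t⟩ - c`. -/
noncomputable def fourierCoeff (φ : OrthonormalBasis (Fin D) ℂ V) (M : V →L[ℂ] V) (c : ℂ) (ψ₀ : V) :
    Option {p : Fin D × Fin D // p.1 ≠ p.2} → ℂ
  | none => ∑ α, (‖inner ℂ (φ α) ψ₀‖ ^ 2 : ℝ) * (inner ℂ (φ α) (M (φ α)) - c)
  | some p => starRingEnd ℂ (inner ℂ (φ p.1.1) ψ₀) * inner ℂ (φ p.1.2) ψ₀ *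
      inner ℂ (φ p.1.1) (M (φ p.1.2))

/-- Absence of resonances includes nondegeneracy: a vanishing gap equals its own negative, which
forces equal indices. Hence only the diagonal terms have frequency `0`. -/
lemma frequency_injective {ħ : ℝ} (hħ : ħ ≠ 0) (hE : NoResonances E) :
    Function.Injective (frequency ħ E) := by
  have h0 : ∀ p : {p : Fin D × Fin D // p.1 ≠ p.2}, frequency ħ E (some p) ≠ 0 := by
    intro p hp
    have h : E p.1.1 - E p.1.2 = 0 := by
      simpa [frequency, hħ] using hp
    rcases hE p.1.1 p.1.2 p.1.2 p.1.1 (by linarith) with h | h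
    · exact p.2 h.1
    · exact p.2 h.1
  rintro (_ | p) (_ | q) h
  · rfl
  · exact absurd h.symm (h0 q)
  · exact absurd h (h0 p)
  · have h' : E p.1.1 - E p.1.2 = E q.1.1 - E q.1.2 := by
      simpa [frequency, div_left_inj' hħ] using h
    rcases hE _ _ _ _ h' with h'' | h''
    · exact congrArg some (Subtype.ext (Prod.ext h''.1 h''.2))
    · exact absurd h''.1 p.2

lemma sum_sum_eq_offDiag_add_diag {M : Type*} [AddCommMonoid M] (f : Fin D → Fin D → M) :
    ∑ α, ∑ β, f α β = ∑ α, f α α + ∑ p : {p : Fin D × Fin D // p.1 ≠ p.2}, f p.1.1 p.1.2 := by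
  rw [← Finset.sum_product', Finset.univ_product_univ,
    ← Finset.sum_filter_add_sum_filter_not _ (fun p : Fin D × Fin D => p.1 = p.2)]
  congr 1
  · rw [Finset.sum_filter, ← Finset.univ_product_univ, Finset.sum_product]
    simp
  · exact Finset.sum_subtype _ (by simp) _

lemma inner_evolve_sub_eq_sum [CompleteSpace V] (hH : IsEigenbasis H E φ) (ħ : ℝ)
    (M : V →L[ℂ] V) (c : ℂ) {ψ₀ : V} (hψ : ‖ψ₀‖ = 1) (t : ℝ) :
    inner ℂ (evolve ħ H ψ₀ t) (M (evolve ħ H ψ₀ t)) - c =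
      ∑ i, fourierCoeff φ M c ψ₀ i * Complex.exp ((frequency ħ E i : ℂ) * Complex.I * t) := by
  -- Spreading `c` over the weights lets the zero-frequency coefficient absorb it.
  have hc : c = ∑ α, ((‖inner ℂ (φ α) ψ₀‖ ^ 2 : ℝ) : ℂ) * c := by
    rw [← Finset.sum_mul, ← Complex.ofReal_sum, φ.sum_sq_norm_inner_right, hψ]
    simp
  have hterm : ∀ α β, inner ℂ
      ((Complex.exp (-(Complex.I * t / ħ) * E α) * inner ℂ (φ α) ψ₀) • φ α)
      (M ((Complex.exp (-(Complex.I * t / ħ) * E β) * inner ℂ (φ β) ψ₀) • φ β)) =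
      starRingEnd ℂ (inner ℂ (φ α) ψ₀) * inner ℂ (φ β) ψ₀ * inner ℂ (φ α) (M (φ β)) *
        Complex.exp (((E α - E β) / ħ : ℝ) * Complex.I * t) := by
    intro α β
    have h : Complex.exp (((E α - E β) / ħ : ℝ) * Complex.I * t) =
        starRingEnd ℂ (Complex.exp (-(Complex.I * t / ħ) * E α)) *
          Complex.exp (-(Complex.I * t / ħ) * E β) := by
      rw [← Complex.exp_conj, ← Complex.exp_add]
      congr 1
      simp only [map_mul, map_neg, map_div₀, Complex.conj_I, Complex.conj_ofReal]
      push_cast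
      ring
    rw [map_smul, inner_smul_left, inner_smul_right, map_mul, h]
    ring
  rw [evolve_eq_sum hH, map_sum, sum_inner]
  simp only [inner_sum, hterm]
  rw [sum_sum_eq_offDiag_add_diag, Fintype.sum_option, add_sub_right_comm]
  congr 1
  simp only [fourierCoeff, frequency, sub_self, zero_div, Complex.ofReal_zero, zero_mul,
    Complex.exp_zero, mul_one, mul_sub, Finset.sum_sub_distrib]
  rw [← hc]
  congr 1
  refine Finset.sum_congr rfl fun α _ => ?_
  rw [Complex.conj_mul', Complex.ofReal_pow]

/-- The mean square of the fluctuations is bounded by the deviations of the matrix elements. -/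
lemma sum_norm_sq_fourierCoeff_le (φ : OrthonormalBasis (Fin D) ℂ V) (M : V →L[ℂ] V) (c : ℂ)
    {ψ₀ : V} (hψ : ‖ψ₀‖ = 1) :
    ∑ i, ‖fourierCoeff φ M c ψ₀ i‖ ^ 2 ≤
      (⨆ p : {p : Fin D × Fin D // p.1 ≠ p.2}, ‖inner ℂ (φ p.1.1) (M (φ p.1.2))‖ ^ 2) +
        ⨆ α : Fin D, ‖inner ℂ (φ α) (M (φ α)) - c‖ ^ 2 := by
  set x := ⨆ p : {p : Fin D × Fin D // p.1 ≠ p.2}, ‖inner ℂ (φ p.1.1) (M (φ p.1.2))‖ ^ 2 with hx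
  set y := ⨆ α : Fin D, ‖inner ℂ (φ α) (M (φ α)) - c‖ ^ 2 with hy
  set w : Fin D → ℝ := fun α => ‖inner ℂ (φ α) ψ₀‖ ^ 2 with hw
  have hw0 : ∀ α, 0 ≤ w α := fun α => by positivity
  have hw1 : ∑ α, w α = 1 := by
    simp only [hw]
    rw [φ.sum_sq_norm_inner_right, hψ, one_pow]
  have hx0 : 0 ≤ x := Real.iSup_nonneg fun p => by positivity
  have hy0 : 0 ≤ y := Real.iSup_nonneg fun p => by positivity
  have hxle : ∀ p : {p : Fin D × Fin D // p.1 ≠ p.2},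
      ‖inner ℂ (φ p.1.1) (M (φ p.1.2))‖ ^ 2 ≤ x := fun p =>
    le_ciSup (f := fun p : {p : Fin D × Fin D // p.1 ≠ p.2} =>
      ‖inner ℂ (φ p.1.1) (M (φ p.1.2))‖ ^ 2) (Set.finite_range _).bddAbove p
  have hyle : ∀ α, ‖inner ℂ (φ α) (M (φ α)) - c‖ ^ 2 ≤ y := fun α =>
    le_ciSup (f := fun α => ‖inner ℂ (φ α) (M (φ α)) - c‖ ^ 2) (Set.finite_range _).bddAbove α
  rw [Fintype.sum_option, add_comm]
  refine add_le_add ?_ ?_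
  · have h1 : ∑ p : {p : Fin D × Fin D // p.1 ≠ p.2}, w p.1.1 * w p.1.2 ≤ 1 := by
      have h := sum_sum_eq_offDiag_add_diag fun α β => w α * w β
      rw [← Finset.sum_mul_sum, hw1, one_mul] at h
      have : 0 ≤ ∑ α, w α * w α := Finset.sum_nonneg fun α _ => mul_self_nonneg _
      linarith
    calc ∑ p : {p : Fin D × Fin D // p.1 ≠ p.2}, ‖fourierCoeff φ M c ψ₀ (some p)‖ ^ 2
        ≤ ∑ p : {p : Fin D × Fin D // p.1 ≠ p.2}, w p.1.1 * w p.1.2 * x := by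
          refine Finset.sum_le_sum fun p _ => ?_
          simp only [fourierCoeff, norm_mul, mul_pow, RCLike.norm_conj]
          exact mul_le_mul_of_nonneg_left (hxle p) (mul_nonneg (hw0 _) (hw0 _))
      _ ≤ 1 * x := by
          rw [← Finset.sum_mul]
          exact mul_le_mul_of_nonneg_right h1 hx0
      _ = x := one_mul x
  · have h1 : ‖fourierCoeff φ M c ψ₀ none‖ ≤ √y := by
      calc ‖fourierCoeff φ M c ψ₀ none‖
          ≤ ∑ α, ‖((w α : ℝ) : ℂ) * (inner ℂ (φ α) (M (φ α)) - c)‖ := norm_sum_le _ _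
        _ ≤ ∑ α, w α * √y := by
            refine Finset.sum_le_sum fun α _ => ?_
            rw [norm_mul, Complex.norm_real, Real.norm_eq_abs, abs_of_nonneg (hw0 α)]
            exact mul_le_mul_of_nonneg_left (Real.le_sqrt_of_sq_le (hyle α)) (hw0 α)
        _ = √y := by rw [← Finset.sum_mul, hw1, one_mul]
    calc _ ≤ √y ^ 2 := pow_le_pow_left₀ (norm_nonneg _) h1 2
      _ = y := Real.sq_sqrt hy0

lemma tr_rhoMC_mul (A : V →L[ℂ] V) : tr (rhoMC V * A) = (Module.finrank ℂ V : ℂ)⁻¹ * tr A := by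
  have : rhoMC V * A = (Module.finrank ℂ V : ℂ)⁻¹ • A := by
    ext x
    simp [rhoMC]
  rw [this, tr, tr, ContinuousLinearMap.toLinearMap_smul, map_smul, smul_eq_mul]

end Dynamics

/-! ### From small deviations to normality. -/

section Normal

variable {V : Type u} [NormedAddCommGroup V] [InnerProductSpace ℂ V] [FiniteDimensional ℂ V]
  {n : ℕ} {d : Fin n → ℕ}

lemma OrthDecomp.proj_mul_proj (𝒟 : OrthDecomp V d) (μ ν : Fin n) :
    𝒟.proj μ * 𝒟.proj ν = if μ = ν then 𝒟.proj ν else 0 := by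
  ext x
  rw [mul_apply_eq_comp]
  have hx : 𝒟.proj ν x ∈ 𝒟.space ν := Submodule.starProjection_apply_mem _ _
  split_ifs with h
  · rw [h]
    exact Submodule.starProjection_eq_self_iff.mpr hx
  · refine (Submodule.starProjection_apply_eq_zero_iff _).mpr ?_
    exact (𝒟.orthogonal ν μ (Ne.symm h)) hx

lemma OrthDecomp.trace_proj (𝒟 : OrthDecomp V d) (ν : Fin n) :
    tr (𝒟.proj ν) = d ν := by
  rw [← 𝒟.finrank_space ν]
  refine LinearMap.IsProj.trace (p := 𝒟.space ν) ⟨fun x => ?_, fun x hx => ?_⟩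
  · exact Submodule.starProjection_apply_mem _ _
  · exact Submodule.starProjection_eq_self_iff.mpr hx

lemma tr_sum_smul_proj (𝒟 : OrthDecomp V d) (a : Fin n → ℝ) :
    tr (∑ ν, (a ν : ℂ) • 𝒟.proj ν) = ∑ ν, (a ν : ℂ) * d ν := by
  simp only [tr, ContinuousLinearMap.toLinearMap_sum, ContinuousLinearMap.toLinearMap_smul, map_sum, map_smul,
    smul_eq_mul]
  exact Finset.sum_congr rfl fun ν _ => by rw [← 𝒟.trace_proj ν]; rfl

lemma sum_smul_proj_sq (𝒟 : OrthDecomp V d) (a : Fin n → ℝ) :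
    (∑ ν, (a ν : ℂ) • 𝒟.proj ν) ^ 2 = ∑ ν, ((a ν ^ 2 : ℝ) : ℂ) • 𝒟.proj ν := by
  rw [sq, Finset.sum_mul_sum]
  refine Finset.sum_congr rfl fun μ _ => ?_
  simp only [smul_mul_smul_comm, 𝒟.proj_mul_proj, smul_ite, smul_zero]
  simp [sq]

/-- If the expectations of the projections are close to their micro-canonical values, then so are
those of all their linear combinations. -/
lemma norm_inner_sub_tr_lt (𝒟 : OrthDecomp V d) {D : ℕ} (hD : Module.finrank ℂ V = D) {ε : ℝ}
    (hε : 0 < ε) {ψ : V} (hψ : ∀ ν, ‖inner ℂ ψ (𝒟.proj ν ψ) - (d ν / D : ℂ)‖ ^ 2 <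
      ε ^ 2 * (d ν / (n * D))) {a : Fin n → ℝ} (ha : ∑ ν, (a ν : ℂ) • 𝒟.proj ν ≠ 0) :
    ‖inner ℂ ψ ((∑ ν, (a ν : ℂ) • 𝒟.proj ν) ψ) - tr (rhoMC V * ∑ ν, (a ν : ℂ) • 𝒟.proj ν)‖ <
      ε * √(tr (rhoMC V * (∑ ν, (a ν : ℂ) • 𝒟.proj ν) ^ 2)).re := by
  obtain ⟨ν₀, hν₀⟩ : ∃ ν, a ν ≠ 0 := by
    by_contra! hcon
    exact ha (by simp [hcon])
  have hn : (0 : ℝ) < n := by exact_mod_cast Fin.pos ν₀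
  have htr2 : (tr (rhoMC V * (∑ ν, (a ν : ℂ) • 𝒟.proj ν) ^ 2)).re = ∑ ν, a ν ^ 2 * (d ν / D) := by
    have : tr (rhoMC V * (∑ ν, (a ν : ℂ) • 𝒟.proj ν) ^ 2) =
        ((∑ ν, a ν ^ 2 * (d ν / D) : ℝ) : ℂ) := by
      rw [sum_smul_proj_sq, tr_rhoMC_mul, tr_sum_smul_proj, hD, Finset.mul_sum]
      push_cast
      exact Finset.sum_congr rfl fun ν _ => by ring
    rw [this, Complex.ofReal_re]
  have hdiff : inner ℂ ψ ((∑ ν, (a ν : ℂ) • 𝒟.proj ν) ψ) -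
      tr (rhoMC V * ∑ ν, (a ν : ℂ) • 𝒟.proj ν) =
      ∑ ν, (a ν : ℂ) * (inner ℂ ψ (𝒟.proj ν ψ) - (d ν / D : ℂ)) := by
    rw [tr_rhoMC_mul, tr_sum_smul_proj, hD, Finset.mul_sum, sum_apply, inner_sum,
      ← Finset.sum_sub_distrib]
    refine Finset.sum_congr rfl fun ν _ => ?_
    rw [smul_apply, inner_smul_right]
    ring
  have hlt : ∀ ν, ‖inner ℂ ψ (𝒟.proj ν ψ) - (d ν / D : ℂ)‖ < ε * √(d ν / (n * D)) := by
    intro ν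
    have h := Real.lt_sqrt_of_sq_lt (hψ ν)
    rwa [Real.sqrt_mul (sq_nonneg ε), Real.sqrt_sq hε.le] at h
  rw [htr2, hdiff]
  calc ‖∑ ν, (a ν : ℂ) * (inner ℂ ψ (𝒟.proj ν ψ) - (d ν / D : ℂ))‖
      ≤ ∑ ν, |a ν| * ‖inner ℂ ψ (𝒟.proj ν ψ) - (d ν / D : ℂ)‖ := by
        refine (norm_sum_le _ _).trans (Finset.sum_le_sum fun ν _ => ?_)
        rw [norm_mul, Complex.norm_real, Real.norm_eq_abs]
    -- Strictness comes from the index `ν₀` with nonzero coefficient.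
    _ < ∑ ν, |a ν| * (ε * √(d ν / (n * D))) := by
        refine Finset.sum_lt_sum (fun ν _ => ?_) ⟨ν₀, Finset.mem_univ _, ?_⟩
        · exact mul_le_mul_of_nonneg_left (hlt ν).le (abs_nonneg _)
        · exact mul_lt_mul_of_pos_left (hlt ν₀) (abs_pos.mpr hν₀)
    _ = ε * ∑ ν, (|a ν| * √(d ν / D)) * (√n)⁻¹ := by
        rw [Finset.mul_sum]
        refine Finset.sum_congr rfl fun ν _ => ?_
        rw [mul_comm (n : ℝ), ← div_div, Real.sqrt_div' _ hn.le]
        ring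
    -- Cauchy–Schwarz against the unit vector with entries `1 / √n`, the origin of the `n` in `d ν /
    -- (n * D)`.
    _ ≤ ε * √(∑ ν, a ν ^ 2 * (d ν / D)) := by
        refine mul_le_mul_of_nonneg_left (Real.le_sqrt_of_sq_le ?_) hε.le
        refine (Finset.sum_mul_sq_le_sq_mul_sq _ _ _).trans (le_of_eq ?_)
        have h1 : ∑ _ν : Fin n, ((√n)⁻¹) ^ 2 = 1 := by
          simp [hn.ne']
        rw [h1, mul_one]
        refine Finset.sum_congr rfl fun ν _ => ?_
        rw [mul_pow, sq_abs, Real.sq_sqrt (by positivity)]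

/-- Each squared fluctuation is divided by its threshold `s ν`, so its time average is at most `δ' /
n`. Where the sum over `ν` is below `1`, every summand is, so one application of Markov's inequality
handles all `ν`. -/
theorem isNormal_of_smallDeviation [CompleteSpace V] {ħ ε δ' : ℝ} (hħ : 0 < ħ) (hε : 0 < ε)
    (hδ' : 0 < δ') {D : ℕ} {𝒟 : OrthDecomp V d} {H : V →L[ℂ] V} {E : Fin D → ℝ}
    {φ : OrthonormalBasis (Fin D) ℂ V} (hH : IsEigenbasis H E φ) (hE : NoResonances E)
    (hdev : SmallDeviation φ 𝒟 ε δ') {ψ₀ : V} (hψ : ‖ψ₀‖ = 1) : IsNormal ħ H 𝒟 ε δ' ψ₀ := by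
  have hD : Module.finrank ℂ V = D := by
    simpa using Module.finrank_eq_card_basis φ.toBasis
  have hdev0 : ∀ ν, 0 ≤ maxDeviation φ 𝒟 ν := fun ν =>
    add_nonneg (Real.iSup_nonneg fun _ => by positivity) (Real.iSup_nonneg fun _ => by positivity)
  set s : Fin n → ℝ := fun ν => ε ^ 2 * (d ν / (n * D)) with hs
  -- The strict bound on a nonnegative deviation rules out vanishing thresholds, such as those with
  -- `d ν = 0`.
  have hs0 : ∀ ν, 0 < s ν := fun ν =>
    pos_of_mul_pos_left ((hdev0 ν).trans_lt (hdev ν)) (by positivity)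
  set f : Fin n → ℝ → ℝ := fun ν t => ‖∑ i, fourierCoeff φ (𝒟.proj ν) (d ν / D : ℂ) ψ₀ i *
    Complex.exp ((frequency ħ E i : ℂ) * Complex.I * t)‖ ^ 2 with hf
  have hfc : ∀ ν, Continuous (f ν) := fun ν => by fun_prop
  have hlim : Tendsto (fun T : ℝ => T⁻¹ * ∫ t in (0 : ℝ)..T, ∑ ν, (s ν)⁻¹ * f ν t) atTop
      (𝓝 (∑ ν, (s ν)⁻¹ * ∑ i, ‖fourierCoeff φ (𝒟.proj ν) (d ν / D : ℂ) ψ₀ i‖ ^ 2)) := by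
    have h := tendsto_finsetSum Finset.univ fun ν (_ : ν ∈ Finset.univ) =>
      (tendsto_average_norm_sq (fourierCoeff φ (𝒟.proj ν) (d ν / D : ℂ) ψ₀)
        (frequency_injective hħ.ne' hE)).const_mul (s ν)⁻¹
    refine h.congr fun T => ?_
    rw [intervalIntegral.integral_finsetSum fun ν _ =>
      ((hfc ν).const_mul _).intervalIntegrable _ _, Finset.mul_sum]
    refine Finset.sum_congr rfl fun ν _ => ?_
    rw [intervalIntegral.integral_const_mul]
    ring
  refine mostTimes_of_tendsto_average (by fun_prop) (fun t => ?_) hlim ?_ fun t ht a A hA hA0 => ?_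
  · exact Finset.sum_nonneg fun ν _ => mul_nonneg (inv_nonneg.mpr (hs0 ν).le) (by positivity)
  · calc ∑ ν, (s ν)⁻¹ * ∑ i, ‖fourierCoeff φ (𝒟.proj ν) (d ν / D : ℂ) ψ₀ i‖ ^ 2
        ≤ ∑ _ν : Fin n, δ' / n := by
          refine Finset.sum_le_sum fun ν _ => ?_
          rw [inv_mul_le_iff₀ (hs0 ν)]
          exact (sum_norm_sq_fourierCoeff_le φ _ _ hψ).trans (hdev ν).le
      _ ≤ δ' := by
          rw [Finset.sum_const, nsmul_eq_mul, Finset.card_univ, Fintype.card_fin]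
          rcases eq_or_ne (n : ℝ) 0 with h | h
          · rw [h, zero_mul]
            exact hδ'.le
          · rw [mul_div_cancel₀ _ h]
  · subst hA
    refine norm_inner_sub_tr_lt 𝒟 hD hε (fun ν => ?_) hA0
    rw [inner_evolve_sub_eq_sum hH ħ _ _ hψ]
    have h : (s ν)⁻¹ * f ν t < 1 := by
      refine lt_of_le_of_lt ?_ ht
      exact Finset.single_le_sum (f := fun ν => (s ν)⁻¹ * f ν t) (fun ν _ =>
        mul_nonneg (inv_nonneg.mpr (hs0 ν).le) (by positivity)) (Finset.mem_univ ν)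
    rwa [inv_mul_lt_iff₀ (hs0 ν), mul_one] at h

end Normal

end QuantumErgodic

theorem mainTheorem1 :
    (∀ (V : Type u) [NormedAddCommGroup V] [InnerProductSpace ℂ V] [CompleteSpace V]
        [FiniteDimensional ℂ V]
        (ħ ε δ' : ℝ), 0 < ħ → 0 < ε → 0 < δ' →
      ∀ (D n : ℕ) (d : Fin n → ℕ) (𝒟 : QuantumErgodic.OrthDecomp V d)
        (H : V →L[ℂ] V) (E : Fin D → ℝ) (φ : OrthonormalBasis (Fin D) ℂ V),
      IsSelfAdjoint H → QuantumErgodic.IsEigenbasis H E φ → QuantumErgodic.NoResonances E →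
      QuantumErgodic.SmallDeviation φ 𝒟 ε δ' →
      ∀ ψ₀ : V, ‖ψ₀‖ = 1 → QuantumErgodic.IsNormal ħ H 𝒟 ε δ' ψ₀) ∧
    (∃ C₁ : ℝ, 0 < C₁ ∧
      ∀ (V : Type u) [NormedAddCommGroup V] [InnerProductSpace ℂ V] [CompleteSpace V]
        [FiniteDimensional ℂ V]
        (ħ ε δ δ' : ℝ), 0 < ħ → 0 < ε → 0 < δ → 0 < δ' →
      ∀ (D n : ℕ) (d : Fin n → ℕ) (hd : ∑ ν, d ν = Module.finrank ℂ V)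
        (H : V →L[ℂ] V) (E : Fin D → ℝ) (φ : OrthonormalBasis (Fin D) ℂ V),
      IsSelfAdjoint H → QuantumErgodic.IsEigenbasis H E φ → QuantumErgodic.NoResonances E →
      (∀ ν, max C₁ (10 * (n : ℝ) ^ 2 / (ε ^ 2 * δ' * δ)) * Real.log D < d ν ∧
        (d ν : ℝ) < D / C₁) →
      1 - δ ≤ (QuantumErgodic.uniformDecomp hd).real
        {𝒟 | QuantumErgodic.SmallDeviation φ 𝒟 ε δ' ∧
          ∀ ψ₀ : V, ‖ψ₀‖ = 1 → QuantumErgodic.IsNormal ħ H 𝒟 ε δ' ψ₀}) := by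

  refine ⟨?_, 10 ^ 10, by norm_num, ?_⟩
  · intro V _ _ _ _ ħ ε δ' hħ hε hδ' D n d 𝒟 H E φ _ hH hE hdev ψ₀ hψ
    exact QuantumErgodic.isNormal_of_smallDeviation hħ hε hδ' hH hE hdev hψ
  · intro V _ _ _ _ ħ ε δ δ' hħ hε hδ hδ' D n d hd H E φ _ hH hE hdν
    refine (QuantumErgodic.uniformDecomp_smallDeviation hε hδ hδ' hd φ hdν).trans
      (measureReal_mono fun 𝒟 hdev => ⟨hdev, fun ψ₀ hψ => ?_⟩)
    exact QuantumErgodic.isNormal_of_smallDeviation hħ hε hδ' hH hE hdev hψ
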